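/- A birth-and-death chain is a discrete-time Markov chain $(X_t)$ on a state space $\Omega=\{0,\dots,n\}$, $n\ge 0$, with transition kernel $P$ satisfying $P(x,y)=0$ whenever $|x-y|>1$; it is lazy if $P(x,x)\ge \frac12$ for all $x\in\Omega$. For an irreducible such chain with stationary distribution $\pi$ let $$d(t)=\max_{x\in\Omega}\|P^t(x,\cdot)-\pi\|_{\mathrm{TV}},\qquad \|\mu-\nu\|_{\mathrm{TV}}=\tfrac12\sum_{x\in\Omega}|\mu(x)-\nu(x)|,\qquad t_{\mathrm{mix}}(\epsilon)=\min\{t\in\mathbb{N}: d(t)\le\epsilon\},$$ and let $t_{\mathrm{rel}}=(1-\lambda)^{-1}$, where $\lambda$ is the largest absolute value of the eigenvalues of $P$ different from $1$ ($\lambda=0$ if there are none). Theorem. For every $0<\epsilon<\frac12$ there is an explicit constant $c_\epsilon>0$, depending only on $\epsilon$, such that every lazy irreducible birth-and-death chain satisfies $$t_{\mathrm{mix}}(\epsilon)-t_{\mathrm{mix}}(1-\epsilon)\le c_\epsilon\sqrt{t_{\mathrm{rel}}\cdot t_{\mathrm{mix}}(\tfrac14)}\,.$$ One may take $$c_\epsilon=\max\Big\{24\max\{1/\epsilon,\,64\},\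 \max\{\epsilon^{-5/2}\log_2(1/\epsilon),\,64\}\Big\}.$$ -/

import Mathlib

namespace BirthDeath

open scoped Matrix

/-- `π` is a stationary distribution of the transition kernel `P`: a probability vector with
`π P = π`. (For an irreducible kernel there is exactly one.) -/
def IsStationaryDistribution {Ω : Type*} [Fintype Ω] (P : Matrix Ω Ω ℝ) (π : Ω → ℝ) : Prop :=
  π ∈ stdSimplex ℝ Ω ∧ π ᵥ* P = π

/-- Total-variation distance of two distributions on a finite set,
`‖μ - ν‖ = (1/2) ∑ₓ |μ(x) - ν(x)|`. -/
noncomputable def tvDist {Ω : Type*} [Fintype Ω] (μ ν : Ω → ℝ) : ℝ :=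
  (1 / 2) * ∑ x, |μ x - ν x|

/-- Worst-case total-variation distance to stationarity at time `t`: the law of the chain at time
`t` started at `x` is the row `P ^ t (x, ·)`. -/
noncomputable def worstDist {Ω : Type*} [Fintype Ω] [DecidableEq Ω]
    (P : Matrix Ω Ω ℝ) (π : Ω → ℝ) (t : ℕ) : ℝ :=
  ⨆ x : Ω, tvDist ((P ^ t) x) π

/-- Total-variation mixing time: the least `t` with `d(t) ≤ ε`. (For a lazy irreducible chain such
`t` exist for every `ε > 0`, so that the infimum is a minimum.) -/
noncomputable def tMix {Ω : Type*} [Fintype Ω] [DecidableEq Ω]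
    (P : Matrix Ω Ω ℝ) (π : Ω → ℝ) (ε : ℝ) : ℕ :=
  sInf {t : ℕ | worstDist P π t ≤ ε}

/-- Largest absolute value of the nontrivial eigenvalues, that is, of those different from `1`,
of the operator `f ↦ P f`. (Irreducible birth-and-death chains are reversible, so all their
eigenvalues are real, and the eigenvalue `1` is simple. For a one-point state space there are no
nontrivial eigenvalues and the value is `0`.) -/
noncomputable def maxNontrivialEigenvalue {Ω : Type*} [Fintype Ω] [DecidableEq Ω]
    (P : Matrix Ω Ω ℝ) : ℝ :=
  sSup {r : ℝ | ∃ μ : ℝ, Module.End.HasEigenvalue (Matrix.toLin' P) μ ∧ μ ≠ 1 ∧ r = |μ|}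

/-- Spectral gap (absolute version). -/
noncomputable def gap {Ω : Type*} [Fintype Ω] [DecidableEq Ω] (P : Matrix Ω Ω ℝ) : ℝ :=
  1 - maxNontrivialEigenvalue P

/-- Relaxation time, the inverse of the spectral gap. -/
noncomputable def tRel {Ω : Type*} [Fintype Ω] [DecidableEq Ω] (P : Matrix Ω Ω ℝ) : ℝ :=
  (gap P)⁻¹

/-- `P` is the transition kernel of a birth-and-death chain on `{0, …, n}`: a Markov chain which at
every step moves to an adjacent state or stays in place. -/
structure IsBirthDeathChain {n : ℕ} (P : Matrix (Fin (n + 1)) (Fin (n + 1)) ℝ) : Prop where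
  stochastic : P ∈ Matrix.rowStochastic ℝ (Fin (n + 1))
  adjacent : ∀ i j : Fin (n + 1), (i : ℕ) + 1 < j ∨ (j : ℕ) + 1 < i → P i j = 0

/-- A chain is lazy if it stays in place with probability at least `1/2` at every state. -/
def IsLazy {Ω : Type*} (P : Matrix Ω Ω ℝ) : Prop :=
  ∀ x, 1 / 2 ≤ P x x

/-- The explicit constant
`c_ε = max {24 · max {1/ε, 64}, max {log₂(1/ε) / ε^(5/2), 64}}`. -/
noncomputable def windowConst (ε : ℝ) : ℝ :=
  max (24 * max (1 / ε) 64) (max (Real.logb 2 (1 / ε) / ε ^ (5 / 2 : ℝ)) 64)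

end BirthDeath

/-!
The kernel of a lazy birth-and-death chain is totally positive of order two, hence its powers
preserve decreasing functions and the distance to stationarity is governed by the chains started at
the two end points; by reflection only the left one needs study. From `0` the hitting time of `m`
has an explicit mean and variance, and functions of the form `(s + mean) ^ 2 + variance` dominate
the powers of `P`. This second-moment bound shows that the chain is still far from stationarity
shortly before the mean hitting time of the `ε / 4`-quantile `a`, and close to it shortly after that
of the `(1 - ε / 4)`-quantile `b`.

The Poincaré inequality with constant `R = tRel P`, tested on the potential of a unit current,
bounds effective resistances between sets of mass `δ` by `2 * R / δ`. This makes both the difference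
of the two means `O(R / ε)` and the variances `O(R * mean / ε)`, while the means are
`O(tMix P π (1 / 4) / ε)`; so everything happens within `O(√(R * tMix P π (1 / 4)) / ε ^ (3 / 2))`.
-/

namespace BirthDeath

open scoped Matrix

section FiniteChain

variable {Ω : Type*} [Fintype Ω] {P : Matrix Ω Ω ℝ} {π : Ω → ℝ}

lemma tvDist_comm (p q : Ω → ℝ) : tvDist p q = tvDist q p := by
  simp only [tvDist, abs_sub_comm]

lemma tvDist_comp_equiv {Ω' : Type*} [Fintype Ω'] (e : Ω' ≃ Ω) (p q : Ω → ℝ) :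
    tvDist (p ∘ e) (q ∘ e) = tvDist p q :=
  congrArg (1 / 2 * ·) (e.sum_comp fun x => |p x - q x|)

lemma abs_dotProduct_sub_dotProduct_le {f : Ω → ℝ} {M : ℝ} (hf : ∀ x, |f x| ≤ M) (p q : Ω → ℝ) :
    |p ⬝ᵥ f - q ⬝ᵥ f| ≤ 2 * M * tvDist p q :=
  calc |p ⬝ᵥ f - q ⬝ᵥ f| = |∑ x, (p x - q x) * f x| := by rw [← sub_dotProduct]; rfl
    _ ≤ ∑ x, |p x - q x| * M := (Finset.abs_sum_le_sum_abs _ _).trans <|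
        Finset.sum_le_sum fun x _ => by
          rw [abs_mul]; exact mul_le_mul_of_nonneg_left (hf x) (abs_nonneg _)
    _ = 2 * M * tvDist p q := by rw [tvDist, ← Finset.sum_mul]; ring

lemma dotProduct_sub_dotProduct_le_tvDist {p q f : Ω → ℝ} (hpq : ∑ x, p x = ∑ x, q x)
    (h₀ : ∀ x, 0 ≤ f x) (h₁ : ∀ x, f x ≤ 1) : p ⬝ᵥ f - q ⬝ᵥ f ≤ tvDist p q := by
  set c : Ω → ℝ := fun _ => 1 / 2
  have hcentered : ∀ x, |(f - c) x| ≤ 1 / 2 := fun x => by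
    simp only [Pi.sub_apply, c]
    exact abs_le.2 ⟨by linarith [h₀ x], by linarith [h₁ x]⟩
  have hconst : p ⬝ᵥ c = q ⬝ᵥ c := by simp only [dotProduct, c, ← Finset.sum_mul, hpq]
  have h := (le_abs_self _).trans (abs_dotProduct_sub_dotProduct_le hcentered p q)
  rw [dotProduct_sub, dotProduct_sub] at h
  linarith

variable [DecidableEq Ω]

lemma tvDist_pow_zero (hπ : π ∈ stdSimplex ℝ Ω) (x : Ω) : tvDist ((P ^ 0) x) π = 1 - π x := by
  have habs : ∀ y, |(P ^ 0) x y - π y| = π y + if x = y then 1 - 2 * π y else 0 := by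
    intro y
    rw [pow_zero, Matrix.one_apply]
    split_ifs with hxy
    · have hle : π y ≤ 1 := hπ.2 ▸ Finset.single_le_sum (fun z _ => hπ.1 z) (Finset.mem_univ y)
      rw [abs_of_nonneg (by linarith)]
      ring
    · rw [zero_sub, abs_neg, abs_of_nonneg (hπ.1 y), add_zero]
  rw [tvDist, Finset.sum_congr rfl fun y _ => habs y, Finset.sum_add_distrib, hπ.2,
    Fintype.sum_ite_eq]
  ring

lemma tvDist_le_worstDist (t : ℕ) (x : Ω) : tvDist ((P ^ t) x) π ≤ worstDist P π t :=
  le_ciSup (Set.finite_range fun x => tvDist ((P ^ t) x) π).bddAbove x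

lemma tMix_le {t : ℕ} {ε : ℝ} (h : worstDist P π t ≤ ε) : tMix P π ε ≤ t := Nat.sInf_le h

lemma worstDist_tMix_le {ε : ℝ} (h : ∃ t, worstDist P π t ≤ ε) :
    worstDist P π (tMix P π ε) ≤ ε := Nat.sInf_mem h

lemma tMix_sub_tMix_le_of_window {ε ε' U v : ℝ} (hε : ε ≤ ε') (hU₀ : 0 ≤ U)
    (hU : ∀ t : ℕ, U ≤ t → worstDist P π t ≤ ε)
    (hv : ∀ t : ℕ, t ≤ U - v → ε' < worstDist P π t) :
    (tMix P π ε : ℝ) - tMix P π ε' ≤ v + 1 := by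
  have hceil : worstDist P π ⌈U⌉₊ ≤ ε := hU _ (Nat.le_ceil U)
  have hupper : (tMix P π ε : ℝ) < U + 1 :=
    (Nat.cast_le.2 (tMix_le hceil)).trans_lt (Nat.ceil_lt_add_one hU₀)
  have hlower : U - v < tMix P π ε' := by
    by_contra! h
    exact (hv _ h).not_ge (worstDist_tMix_le ⟨_, hceil.trans hε⟩)
  linarith

lemma half_le_worstDist_zero [Nontrivial Ω] (hπ : π ∈ stdSimplex ℝ Ω) :
    1 / 2 ≤ worstDist P π 0 := by
  obtain ⟨x, y, hxy⟩ := exists_pair_ne Ω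
  have hsum : π x + π y ≤ 1 := by
    rw [← hπ.2, ← Finset.sum_pair hxy]
    exact Finset.sum_le_sum_of_subset_of_nonneg (Finset.subset_univ _) fun z _ _ => hπ.1 z
  have hdist : ∀ z, 1 - π z ≤ worstDist P π 0 := fun z => by
    rw [← tvDist_pow_zero (P := P) hπ z]
    exact tvDist_le_worstDist 0 z
  linarith [hdist x, hdist y]

lemma one_le_tMix [Nontrivial Ω] (hπ : π ∈ stdSimplex ℝ Ω) {ε : ℝ} (hε : ε < 1 / 2)
    (h : ∃ t, worstDist P π t ≤ ε) : 1 ≤ tMix P π ε := by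
  by_contra! hlt
  have := worstDist_tMix_le h
  rw [Nat.lt_one_iff.1 hlt] at this
  linarith [half_le_worstDist_zero (P := P) hπ]

lemma tMix_eq_zero_of_subsingleton [Subsingleton Ω] (hπ : π ∈ stdSimplex ℝ Ω) {ε : ℝ}
    (hε : 0 ≤ ε) : tMix P π ε = 0 := by
  refine Nat.le_zero.1 (tMix_le ((Real.iSup_le fun x => ?_) hε))
  have hx : π x = 1 := (Fintype.sum_subsingleton π x).symm.trans hπ.2
  rwa [tvDist_pow_zero hπ, hx, sub_self]

lemma sum_pow_apply (hP : P ∈ Matrix.rowStochastic ℝ Ω) (t : ℕ) (x : Ω) :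
    ∑ y, (P ^ t) x y = 1 :=
  Matrix.sum_row_of_mem_rowStochastic (pow_mem hP t) x

lemma pow_succ_mulVec (P : Matrix Ω Ω ℝ) (t : ℕ) (f : Ω → ℝ) :
    P ^ (t + 1) *ᵥ f = P *ᵥ (P ^ t *ᵥ f) := by
  rw [pow_succ', Matrix.mulVec_mulVec]

lemma pow_mulVec_eq_pow_smul {μ : ℝ} {f : Ω → ℝ} (hf : P *ᵥ f = μ • f) (t : ℕ) :
    P ^ t *ᵥ f = μ ^ t • f := by
  induction t with
  | zero => rw [pow_zero, Matrix.one_mulVec, pow_zero, one_smul]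
  | succ t ih => rw [pow_succ_mulVec, ih, Matrix.mulVec_smul, hf, smul_smul, pow_succ]

lemma pow_mulVec_le_of_supersolution (hP : ∀ x y, 0 ≤ P x y) {f : Ω → ℝ} {u : ℕ → Ω → ℝ}
    (D : Set Ω) (hinit : f ≤ u 0) (hstep : ∀ t, ∀ x ∈ D, (P *ᵥ u t) x ≤ u (t + 1) x)
    (hoff : ∀ t, ∀ x ∉ D, (P ^ t *ᵥ f) x ≤ u t x) (t : ℕ) : P ^ t *ᵥ f ≤ u t := by
  induction t with
  | zero => simpa only [pow_zero, Matrix.one_mulVec] using hinit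
  | succ t ih =>
    intro x
    by_cases hx : x ∈ D
    · rw [pow_succ_mulVec]
      exact (dotProduct_le_dotProduct_of_nonneg_left ih (hP x)).trans (hstep t x hx)
    · exact hoff (t + 1) x hx

lemma eq_of_mulVec_eq_self (hP : P ∈ Matrix.rowStochastic ℝ Ω) (hirr : P.IsIrreducible)
    {f : Ω → ℝ} (hf : P *ᵥ f = f) (x y : Ω) : f x = f y := by
  have : Nonempty Ω := ⟨x⟩
  obtain ⟨z, hz⟩ := Finite.exists_max f
  suffices h : ∀ y, f y = f z from (h x).trans (h y).symm
  intro y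
  obtain ⟨k, -, hk⟩ := (Matrix.isIrreducible_iff_exists_pow_pos hirr.nonneg).1 hirr z y
  have hpow : P ^ k *ᵥ f = f := by
    simpa only [one_pow, one_smul] using
      pow_mulVec_eq_pow_smul (μ := 1) (hf.trans (one_smul ℝ f).symm) k
  have hdefect : ∑ w, (P ^ k) z w * (f z - f w) = 0 := by
    simp only [mul_sub, Finset.sum_sub_distrib, ← Finset.sum_mul, sum_pow_apply hP, one_mul]
    exact sub_eq_zero.2 (congrFun hpow z).symm
  have hterm := (Finset.sum_eq_zero_iff_of_nonneg fun w _ => mul_nonneg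
    (Matrix.nonneg_of_mem_rowStochastic (pow_mem hP k)) (sub_nonneg.2 (hz w))).1 hdefect y
    (Finset.mem_univ y)
  linarith [(mul_eq_zero.1 hterm).resolve_left hk.ne']

namespace IsStationaryDistribution

variable (hπ : IsStationaryDistribution P π)
include hπ

lemma vecMul_pow (t : ℕ) : π ᵥ* P ^ t = π := by
  induction t with
  | zero => rw [pow_zero, Matrix.vecMul_one]
  | succ t ih => rw [pow_succ, ← Matrix.vecMul_vecMul, ih, hπ.2]

lemma dotProduct_pow_mulVec (t : ℕ) (f : Ω → ℝ) : π ⬝ᵥ (P ^ t *ᵥ f) = π ⬝ᵥ f := by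
  rw [Matrix.dotProduct_mulVec, hπ.vecMul_pow]

omit [DecidableEq Ω] in
lemma pos (hirr : P.IsIrreducible) (y : Ω) : 0 < π y := by
  classical
  obtain ⟨x, -, hx⟩ : ∃ x ∈ Finset.univ, 0 < π x :=
    Finset.exists_lt_of_sum_lt (by simp [hπ.1.2])
  obtain ⟨k, -, hk⟩ := (Matrix.isIrreducible_iff_exists_pow_pos hirr.nonneg).1 hirr x y
  rw [← hπ.vecMul_pow k]
  exact (mul_pos hx hk).trans_le <| Finset.single_le_sum (f := fun z => π z * (P ^ k) z y)
    (fun z _ => mul_nonneg (hπ.1.1 z) (Matrix.pow_apply_nonneg hirr.nonneg k z y))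
    (Finset.mem_univ x)

lemma worstDist_le {t : ℕ} {η : ℝ} (h : ∀ x y, tvDist ((P ^ t) x) ((P ^ t) y) ≤ η) :
    worstDist P π t ≤ η := by
  have hne : Nonempty Ω := by
    by_contra hempty
    have := hπ.1.2
    simp [not_nonempty_iff.1 hempty] at this
  refine ciSup_le fun x => ?_
  have hmix : ∀ z, |(P ^ t) x z - π z| ≤ ∑ y, π y * |(P ^ t) x z - (P ^ t) y z| := fun z => by
    have hz : (P ^ t) x z - π z = ∑ y, π y * ((P ^ t) x z - (P ^ t) y z) := by
      conv_lhs => rw [← hπ.vecMul_pow t]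
      simp only [mul_sub, Finset.sum_sub_distrib, ← Finset.sum_mul, hπ.1.2, one_mul]
      rfl
    rw [hz]
    exact (Finset.abs_sum_le_sum_abs _ _).trans_eq <| Finset.sum_congr rfl fun y _ => by
      rw [abs_mul, abs_of_nonneg (hπ.1.1 y)]
  calc tvDist ((P ^ t) x) π
      ≤ 1 / 2 * ∑ z, ∑ y, π y * |(P ^ t) x z - (P ^ t) y z| :=
        mul_le_mul_of_nonneg_left (Finset.sum_le_sum fun z _ => hmix z) (by norm_num)
    _ = ∑ y, π y * tvDist ((P ^ t) x) ((P ^ t) y) := by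
        rw [Finset.sum_comm, Finset.mul_sum]
        exact Finset.sum_congr rfl fun y _ => by rw [tvDist, ← Finset.mul_sum]; ring
    _ ≤ ∑ y, π y * η := Finset.sum_le_sum fun y _ =>
        mul_le_mul_of_nonneg_left (h x y) (hπ.1.1 y)
    _ = η := by rw [← Finset.sum_mul, hπ.1.2, one_mul]

end IsStationaryDistribution

end FiniteChain

section Spectral

variable {Ω : Type*} {P : Matrix Ω Ω ℝ} {π : Ω → ℝ}

/-- Reversibility of the kernel `P` with respect to `π`, in the form of detailed balance. -/
def IsReversible (P : Matrix Ω Ω ℝ) (π : Ω → ℝ) : Prop :=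
  ∀ x y, π x * P x y = π y * P y x

/-- The kernel `P` as an operator on `ℓ²(π)`, written in the orthonormal basis of normalized
indicator functions. It is symmetric exactly when `P` is reversible. -/
noncomputable def symmetrization (P : Matrix Ω Ω ℝ) (π : Ω → ℝ) : Matrix Ω Ω ℝ :=
  Matrix.of fun x y => √(π x) * P x y / √(π y)

lemma IsReversible.isHermitian_symmetrization (hrev : IsReversible P π) (hpos : ∀ x, 0 < π x) :
    (symmetrization P π).IsHermitian := by
  ext x y
  have hs : ∀ z, √(π z) ≠ 0 := fun z => (Real.sqrt_pos.2 (hpos z)).ne'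
  have hbal := hrev y x
  rw [← Real.mul_self_sqrt (hpos x).le, ← Real.mul_self_sqrt (hpos y).le] at hbal
  simp only [symmetrization, Matrix.conjTranspose_apply, Matrix.of_apply, star_trivial]
  rw [div_eq_div_iff (hs x) (hs y)]
  linarith

variable [Fintype Ω]

/-- The Dirichlet form `⟨f, (I - P) f⟩` in `ℓ²(π)`. -/
def dirichletForm (P : Matrix Ω Ω ℝ) (π : Ω → ℝ) (f : Ω → ℝ) : ℝ :=
  ∑ x, f x * (π x * (f x - (P *ᵥ f) x))

/-- The Poincaré inequality with constant `R`: the variance under `π` of any function is at most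
`R` times its Dirichlet form. -/
def HasPoincare (P : Matrix Ω Ω ℝ) (π : Ω → ℝ) (R : ℝ) : Prop :=
  ∀ f : Ω → ℝ, ∑ x, π x * (f x - π ⬝ᵥ f) ^ 2 ≤ R * dirichletForm P π f

lemma symmetrization_mulVec (hpos : ∀ x, 0 < π x) (f : Ω → ℝ) (x : Ω) :
    (symmetrization P π *ᵥ fun y => √(π y) * f y) x = √(π x) * (P *ᵥ f) x := by
  simp only [symmetrization, Matrix.mulVec, dotProduct, Matrix.of_apply, Finset.mul_sum]
  refine Finset.sum_congr rfl fun y _ => ?_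
  have := (Real.sqrt_pos.2 (hpos y)).ne'
  field_simp

lemma dotProduct_mulVec_le_of_isHermitian {A : Matrix Ω Ω ℝ}
    (hA : A.IsHermitian) {l : ℝ} {g : Ω → ℝ}
    (h : ∀ μ v, v ≠ 0 → A *ᵥ v = μ • v → μ ≤ l ∨ v ⬝ᵥ g = 0) :
    g ⬝ᵥ (A *ᵥ g) ≤ l * (g ⬝ᵥ g) := by
  classical
  set v : Ω → Ω → ℝ := fun i => (hA.eigenvectorBasis i).ofLp
  have hinner : ∀ a b : Ω → ℝ, inner ℝ (WithLp.toLp 2 a) (WithLp.toLp 2 b) = a ⬝ᵥ b := fun a b => by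
    rw [EuclideanSpace.inner_toLp_toLp, star_trivial, dotProduct_comm]
  have hparseval : ∀ a b, ∑ i, (v i ⬝ᵥ a) * (v i ⬝ᵥ b) = a ⬝ᵥ b := fun a b => by
    rw [← hinner a b, ← hA.eigenvectorBasis.sum_inner_mul_inner]
    refine Finset.sum_congr rfl fun i _ => ?_
    rw [← hinner, ← hinner, real_inner_comm]
  have hAv : ∀ i, A *ᵥ v i = hA.eigenvalues i • v i := hA.mulVec_eigenvectorBasis
  have hdot : ∀ i, v i ⬝ᵥ (A *ᵥ g) = hA.eigenvalues i * (v i ⬝ᵥ g) := fun i => by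
    have hT : Aᵀ = A := Matrix.conjTranspose_eq_transpose_of_trivial A ▸ hA
    rw [Matrix.dotProduct_mulVec, ← Matrix.mulVec_transpose, hT, hAv, smul_dotProduct,
      smul_eq_mul]
  rw [← hparseval, ← hparseval, Finset.mul_sum]
  refine Finset.sum_le_sum fun i _ => ?_
  have hvi : v i ≠ 0 := fun h0 => hA.eigenvectorBasis.toBasis.ne_zero i <| by
    rw [OrthonormalBasis.coe_toBasis]
    exact congrArg (WithLp.toLp 2) h0
  rw [hdot]
  rcases h _ _ hvi (hAv i) with hle | hzero
  · nlinarith [mul_self_nonneg (v i ⬝ᵥ g)]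
  · simp only [hzero, mul_zero, le_refl]

variable [DecidableEq Ω]

lemma hasEigenvalue_toLin'_of_mulVec {μ : ℝ} {f : Ω → ℝ} (hf : P *ᵥ f = μ • f) (hf₀ : f ≠ 0) :
    Module.End.HasEigenvalue (Matrix.toLin' P) μ :=
  Module.End.hasEigenvalue_of_hasEigenvector ⟨Module.End.mem_eigenspace_iff.2 hf, hf₀⟩

lemma abs_le_maxNontrivialEigenvalue {μ : ℝ}
    (hμ : Module.End.HasEigenvalue (Matrix.toLin' P) μ) (hμ₁ : μ ≠ 1) :
    |μ| ≤ maxNontrivialEigenvalue P := by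
  refine le_csSup (Set.Finite.bddAbove ?_) ⟨μ, hμ, hμ₁, rfl⟩
  refine ((Module.End.finite_hasEigenvalue (Matrix.toLin' P)).image abs).subset ?_
  rintro _ ⟨ν, hν, -, rfl⟩
  exact ⟨ν, hν, rfl⟩

lemma gap_le_one (P : Matrix Ω Ω ℝ) : gap P ≤ 1 := by
  refine sub_le_self 1 (Real.sSup_nonneg ?_)
  rintro _ ⟨μ, -, -, rfl⟩
  exact abs_nonneg μ

lemma one_le_tRel (hgap : 0 < gap P) : 1 ≤ tRel P := (one_le_inv₀ hgap).2 (gap_le_one P)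

namespace IsStationaryDistribution

variable (hπ : IsStationaryDistribution P π)
include hπ

omit [DecidableEq Ω] in
lemma dirichletForm_sub_const (hP : ∀ x, ∑ y, P x y = 1) (f : Ω → ℝ) (c : ℝ) :
    dirichletForm P π (fun x => f x - c) = dirichletForm P π f := by
  have hPc : ∀ x, (P *ᵥ fun y => f y - c) x = (P *ᵥ f) x - c := fun x => by
    simp only [Matrix.mulVec, dotProduct, mul_sub, Finset.sum_sub_distrib, ← Finset.sum_mul, hP,
      one_mul]
  have hflow : ∑ x, π x * (f x - (P *ᵥ f) x) = 0 := by
    simp only [mul_sub, Finset.sum_sub_distrib]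
    have hinv : π ⬝ᵥ (P *ᵥ f) = π ⬝ᵥ f := by rw [Matrix.dotProduct_mulVec, hπ.2]
    exact sub_eq_zero.2 hinv.symm
  simp only [dirichletForm, hPc, sub_sub_sub_cancel_right]
  simp only [sub_mul, Finset.sum_sub_distrib, ← Finset.mul_sum, hflow, mul_zero, sub_zero]

lemma dotProduct_symmetrization_mulVec_le (hP : P ∈ Matrix.rowStochastic ℝ Ω)
    (hirr : P.IsIrreducible) (hrev : IsReversible P π) {f : Ω → ℝ} (hf : π ⬝ᵥ f = 0)
    {g : Ω → ℝ} (hg : ∀ x, g x = √(π x) * f x) :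
    g ⬝ᵥ (symmetrization P π *ᵥ g) ≤ maxNontrivialEigenvalue P * (g ⬝ᵥ g) := by
  have hpos := hπ.pos hirr
  have hs : ∀ x, √(π x) ≠ 0 := fun x => (Real.sqrt_pos.2 (hpos x)).ne'
  refine dotProduct_mulVec_le_of_isHermitian (hrev.isHermitian_symmetrization hpos) ?_
  intro μ v hv hμ
  obtain ⟨w, rfl⟩ : ∃ w : Ω → ℝ, v = fun x => √(π x) * w x :=
    ⟨fun x => v x / √(π x), funext fun x => (mul_div_cancel₀ _ (hs x)).symm⟩
  have hw : P *ᵥ w = μ • w := funext fun x => mul_left_cancel₀ (hs x) <| by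
    rw [← symmetrization_mulVec hpos, hμ]
    simp only [Pi.smul_apply, smul_eq_mul]
    ring
  by_cases hμ₁ : μ = 1
  · obtain ⟨x₀, -⟩ := Function.ne_iff.1 hv
    have hconst := eq_of_mulVec_eq_self hP hirr (hw.trans (by rw [hμ₁, one_smul]))
    refine Or.inr ?_
    calc ∑ x, √(π x) * w x * g x = ∑ x, w x₀ * (π x * f x) := Finset.sum_congr rfl fun x _ => by
          rw [hconst x x₀, hg]
          linear_combination w x₀ * f x * Real.mul_self_sqrt (hpos x).le
      _ = w x₀ * (π ⬝ᵥ f) := (Finset.mul_sum _ _ _).symm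
      _ = 0 := by rw [hf, mul_zero]
  · have hw₀ : w ≠ 0 := fun h0 => hv (funext fun x => by simp only [h0, Pi.zero_apply, mul_zero])
    exact Or.inl ((le_abs_self μ).trans <|
      abs_le_maxNontrivialEigenvalue (hasEigenvalue_toLin'_of_mulVec hw hw₀) hμ₁)

lemma hasPoincare_tRel (hP : P ∈ Matrix.rowStochastic ℝ Ω) (hirr : P.IsIrreducible)
    (hrev : IsReversible P π) (hgap : 0 < gap P) : HasPoincare P π (tRel P) := by
  intro f
  have hpos := hπ.pos hirr
  set f₀ : Ω → ℝ := fun x => f x - π ⬝ᵥ f with hf₀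
  set g : Ω → ℝ := fun x => √(π x) * f₀ x
  have hmean : π ⬝ᵥ f₀ = 0 := by
    simp only [dotProduct, hf₀, mul_sub, Finset.sum_sub_distrib, ← Finset.sum_mul, hπ.1.2,
      one_mul, sub_self]
  have hspec := hπ.dotProduct_symmetrization_mulVec_le hP hirr hrev hmean (g := g) fun _ => rfl
  have hvar : g ⬝ᵥ g = ∑ x, π x * f₀ x ^ 2 := Finset.sum_congr rfl fun x _ => by
    rw [mul_mul_mul_comm, Real.mul_self_sqrt (hpos x).le, sq]
  have henergy : dirichletForm P π f = g ⬝ᵥ g - g ⬝ᵥ (symmetrization P π *ᵥ g) := by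
    rw [← hπ.dirichletForm_sub_const (Matrix.sum_row_of_mem_rowStochastic hP) f (π ⬝ᵥ f),
      ← dotProduct_sub]
    refine Finset.sum_congr rfl fun x _ => ?_
    rw [Pi.sub_apply, symmetrization_mulVec hpos, ← mul_sub, mul_mul_mul_comm,
      Real.mul_self_sqrt (hpos x).le]
    ring
  rw [← hvar, henergy, tRel, ← div_eq_inv_mul, le_div_iff₀ hgap, gap]
  linarith

lemma abs_eigenvalue_pow_le {μ : ℝ} (hμ : Module.End.HasEigenvalue (Matrix.toLin' P) μ)
    (hμ₁ : μ ≠ 1) (t : ℕ) : |μ| ^ t ≤ 2 * worstDist P π t := by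
  obtain ⟨f, hf, hf₀⟩ := hμ.exists_hasEigenvector
  rw [Module.End.mem_eigenspace_iff, Matrix.toLin'_apply] at hf
  have hmean : π ⬝ᵥ f = 0 := by
    have h := hπ.dotProduct_pow_mulVec 1 f
    rw [pow_one, hf, dotProduct_smul, smul_eq_mul] at h
    exact (mul_eq_zero.1 (by linarith : (μ - 1) * (π ⬝ᵥ f) = 0)).resolve_left (sub_ne_zero.2 hμ₁)
  obtain ⟨x₀, hx₀⟩ := Function.ne_iff.1 hf₀
  have : Nonempty Ω := ⟨x₀⟩
  obtain ⟨x, hx⟩ := Finite.exists_max fun x => |f x|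
  have hpos : 0 < |f x| := (abs_pos.2 hx₀).trans_le (hx x₀)
  refine le_of_mul_le_mul_right ?_ hpos
  calc |μ| ^ t * |f x| = |(P ^ t) x ⬝ᵥ f - π ⬝ᵥ f| := by
        rw [hmean, sub_zero, ← abs_pow, ← abs_mul]
        exact congrArg abs (congrFun (pow_mulVec_eq_pow_smul hf t) x).symm
    _ ≤ 2 * |f x| * tvDist ((P ^ t) x) π := abs_dotProduct_sub_dotProduct_le hx _ _
    _ ≤ 2 * |f x| * worstDist P π t := by gcongr; exact tvDist_le_worstDist t x
    _ = 2 * worstDist P π t * |f x| := by ring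

lemma one_div_two_mul_le_gap {T : ℕ} (hT : 1 ≤ T) (h : worstDist P π T ≤ 1 / 4) :
    1 / (2 * T : ℝ) ≤ gap P := by
  have hT' : (1 : ℝ) ≤ T := by exact_mod_cast hT
  have hT₂ : 1 / (2 * T : ℝ) ≤ 1 := (div_le_one (by positivity)).2 (by linarith)
  suffices hmax : maxNontrivialEigenvalue P ≤ 1 - 1 / (2 * T) by
    rw [gap]
    linarith
  refine Real.sSup_le ?_ (by linarith)
  rintro _ ⟨μ, hμ, hμ₁, rfl⟩
  have hdecay := hπ.abs_eigenvalue_pow_le hμ hμ₁ T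
  have hbernoulli := one_add_mul_le_pow (a := |μ| - 1) (by linarith [abs_nonneg μ]) T
  rw [add_sub_cancel] at hbernoulli
  have hle : 1 / (2 * T : ℝ) ≤ 1 - |μ| := by
    rw [div_le_iff₀ (by positivity)]
    linarith
  linarith

lemma tRel_le {T : ℕ} (hT : 1 ≤ T) (h : worstDist P π T ≤ 1 / 4) : tRel P ≤ 2 * T := by
  rw [tRel, ← inv_inv (2 * T : ℝ), ← one_div (2 * T : ℝ)]
  exact inv_anti₀ (by positivity) (hπ.one_div_two_mul_le_gap hT h)

end IsStationaryDistribution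

end Spectral

section TotalPositivity

/-- Total positivity of order two: all minors of order two are nonnegative. -/
def IsTP2 {α β : Type*} [LE α] [LE β] (M : Matrix α β ℝ) : Prop :=
  ∀ ⦃i i'⦄, i ≤ i' → ∀ ⦃j j'⦄, j ≤ j' → M i j' * M i' j ≤ M i j * M i' j'

lemma dotProduct_mul_dotProduct_le_of_minors {Ω : Type*} [LinearOrder Ω] [Fintype Ω]
    {a b c d : Ω → ℝ} (hab : ∀ k l, k ≤ l → a l * b k ≤ a k * b l)
    (hcd : ∀ k l, k ≤ l → c l * d k ≤ c k * d l) :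
    (a ⬝ᵥ d) * (b ⬝ᵥ c) ≤ (a ⬝ᵥ c) * (b ⬝ᵥ d) := by
  have hcauchyBinet : ∑ k, ∑ l, (a k * b l - a l * b k) * (c k * d l - c l * d k) =
      2 * ((a ⬝ᵥ c) * (b ⬝ᵥ d) - (a ⬝ᵥ d) * (b ⬝ᵥ c)) := by
    have hexpand : ∀ k l, (a k * b l - a l * b k) * (c k * d l - c l * d k) =
        (a k * c k) * (b l * d l) + (b k * d k) * (a l * c l) -
          ((a k * d k) * (b l * c l) + (b k * c k) * (a l * d l)) := fun k l => by ring
    simp only [hexpand, Finset.sum_sub_distrib, Finset.sum_add_distrib, ← Finset.sum_mul_sum]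
    simp only [dotProduct]
    ring
  have hnonneg : 0 ≤ ∑ k, ∑ l, (a k * b l - a l * b k) * (c k * d l - c l * d k) := by
    refine Finset.sum_nonneg fun k _ => Finset.sum_nonneg fun l _ => ?_
    rcases le_total k l with h | h
    · exact mul_nonneg (sub_nonneg.2 (hab k l h)) (sub_nonneg.2 (hcd k l h))
    · exact mul_nonneg_of_nonpos_of_nonpos (by linarith [hab l k h]) (by linarith [hcd l k h])
  linarith

variable {α β Ω : Type*}

namespace IsTP2

lemma mul [LE α] [LE β] [LinearOrder Ω] [Fintype Ω] {M : Matrix α Ω ℝ} {N : Matrix Ω β ℝ}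
    (hM : IsTP2 M) (hN : IsTP2 N) : IsTP2 (M * N) := by
  intro i i' hi j j' hj
  exact dotProduct_mul_dotProduct_le_of_minors (fun k l h => hM hi h) fun k l h =>
    (mul_comm _ _).trans_le (hN h hj)

lemma one [PartialOrder Ω] [DecidableEq Ω] : IsTP2 (1 : Matrix Ω Ω ℝ) := by
  intro i i' hi j j' hj
  by_cases h : i = j' ∧ i' = j
  · obtain ⟨rfl, rfl⟩ := h
    rw [hi.antisymm hj]
  · have hnn : 0 ≤ (1 : Matrix Ω Ω ℝ) i j * (1 : Matrix Ω Ω ℝ) i' j' := by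
      simp only [Matrix.one_apply]
      positivity
    rcases not_and_or.1 h with h | h
    · rwa [Matrix.one_apply_ne h, zero_mul]
    · rwa [Matrix.one_apply_ne h, mul_zero]

lemma pow [LinearOrder Ω] [Fintype Ω] {M : Matrix Ω Ω ℝ} (hM : IsTP2 M) (t : ℕ) :
    IsTP2 (M ^ t) := by
  induction t with
  | zero => rw [pow_zero]; exact one
  | succ t ih => rw [pow_succ]; exact ih.mul hM

lemma submatrix_antitone [Preorder α] [Preorder β] {α' β' : Type*} [Preorder α'] [Preorder β']
    {M : Matrix α β ℝ} (hM : IsTP2 M) {f : α' → α} {g : β' → β} (hf : Antitone f)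
    (hg : Antitone g) : IsTP2 (M.submatrix f g) := by
  intro i i' hi j j' hj
  have := hM (hf hi) (hg hj)
  simp only [Matrix.submatrix_apply]
  linarith

end IsTP2

end TotalPositivity

section LikelihoodRatio

lemma tvDist_eq_dotProduct_sub {Ω : Type*} [Fintype Ω] {p q f : Ω → ℝ}
    (hpq : ∑ x, p x = ∑ x, q x) (hf : ∀ x, f x = 1 ∧ q x ≤ p x ∨ f x = 0 ∧ p x ≤ q x) :
    tvDist p q = p ⬝ᵥ f - q ⬝ᵥ f := by
  have habs : ∀ x, |p x - q x| = 2 * (p x * f x - q x * f x) - (p x - q x) := fun x => by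
    rcases hf x with ⟨hx, hle⟩ | ⟨hx, hle⟩
    · rw [hx, abs_of_nonneg (by linarith)]; ring
    · rw [hx, abs_of_nonpos (by linarith)]; ring
  simp only [tvDist, habs, Finset.sum_sub_distrib, ← Finset.mul_sum, hpq, sub_self, sub_zero]
  simp only [dotProduct]
  ring

/-- The indicator function of the states strictly below `k`. -/
def below {n : ℕ} (k : ℕ) : Fin (n + 1) → ℝ := fun x => if (x : ℕ) < k then 1 else 0

variable {n : ℕ}

lemma below_nonneg (k : ℕ) (x : Fin (n + 1)) : 0 ≤ below k x := by
  unfold below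
  split_ifs <;> norm_num

lemma below_le_one (k : ℕ) (x : Fin (n + 1)) : below k x ≤ 1 := by
  unfold below
  split_ifs <;> norm_num

lemma below_antitone (k : ℕ) : Antitone (below k : Fin (n + 1) → ℝ) := by
  intro x y hxy
  have : (x : ℕ) ≤ y := hxy
  unfold below
  split_ifs <;> first | omega | norm_num

lemma below_mono {k l : ℕ} (h : k ≤ l) : (below k : Fin (n + 1) → ℝ) ≤ below l := by
  intro x
  unfold below
  split_ifs <;> first | omega | norm_num

lemma below_top : (below (n + 1) : Fin (n + 1) → ℝ) = 1 :=
  funext fun x => if_pos x.2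

lemma below_rev (k : ℕ) (x : Fin (n + 1)) : below k x.rev = 1 - below (n + 1 - k) x := by
  have := x.2
  simp only [below, Fin.val_rev]
  split_ifs <;> first | omega | norm_num

lemma comp_rev_dotProduct_below {p : Fin (n + 1) → ℝ} (hp : ∑ x, p x = 1) (k : ℕ) :
    (p ∘ Fin.rev) ⬝ᵥ below k = 1 - p ⬝ᵥ below (n + 1 - k) := by
  have hrev : below k ∘ Fin.revPerm = 1 - below (n + 1 - k) := funext (below_rev k)
  refine (comp_equiv_symm_dotProduct p (below k) Fin.revPerm).trans ?_
  rw [hrev, dotProduct_sub, dotProduct_one, hp]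

lemma exists_tvDist_eq_below {p q : Fin (n + 1) → ℝ} (hp : ∀ j, 0 ≤ p j) (hq : ∀ j, 0 ≤ q j)
    (hpq : ∑ j, p j = ∑ j, q j) (h : ∀ j j', j ≤ j' → p j' * q j ≤ p j * q j') :
    ∃ k ≤ n + 1, tvDist p q = p ⬝ᵥ below k - q ⬝ᵥ below k := by
  classical
  set s : Finset (Fin (n + 1)) := {x | q x < p x}
  refine ⟨s.sup fun x => (x : ℕ) + 1, Finset.sup_le fun x _ => x.2,
    tvDist_eq_dotProduct_sub hpq fun j => ?_⟩
  by_cases hj : (j : ℕ) < s.sup fun x => (x : ℕ) + 1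
  · obtain ⟨x, hx, hjx⟩ := Finset.lt_sup_iff.1 hj
    have hx : q x < p x := (Finset.mem_filter.1 hx).2
    refine Or.inl ⟨if_pos hj, ?_⟩
    by_contra! hlt
    have hratio := h j x (Fin.le_def.2 (Nat.lt_succ_iff.1 hjx))
    have h₁ : q x * q j < p x * q j := mul_lt_mul_of_pos_right hx ((hp j).trans_lt hlt)
    have h₂ : p j * q x ≤ q j * q x := mul_le_mul_of_nonneg_right hlt.le (hq x)
    linarith
  · refine Or.inr ⟨if_neg hj, not_lt.1 fun hlt => hj ?_⟩
    have hmem : j ∈ s := Finset.mem_filter.2 ⟨Finset.mem_univ j, hlt⟩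
    exact Nat.lt_of_succ_le (Finset.le_sup (f := fun x : Fin (n + 1) => (x : ℕ) + 1) hmem)

end LikelihoodRatio

section TP2Chain

lemma IsTP2.mulVec_antitone {Ω : Type*} [LinearOrder Ω] [Fintype Ω] {M : Matrix Ω Ω ℝ}
    (hM : IsTP2 M) (hrow : ∀ i, ∑ j, M i j = 1) {f : Ω → ℝ} (hf : Antitone f) :
    Antitone (M *ᵥ f) := by
  intro i i' hi
  have h := dotProduct_mul_dotProduct_le_of_minors (fun k l h => hM hi h)
    (c := f) (d := 1) fun k l h => by simpa only [Pi.one_apply, mul_one] using hf h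
  rwa [dotProduct_one, dotProduct_one, hrow, hrow, one_mul, mul_one] at h

variable {n : ℕ} {P : Matrix (Fin (n + 1)) (Fin (n + 1)) ℝ} {π : Fin (n + 1) → ℝ}

lemma IsTP2.worstDist_le (hTP : IsTP2 P) (hP : P ∈ Matrix.rowStochastic ℝ (Fin (n + 1)))
    (hπ : IsStationaryDistribution P π) {t : ℕ} {η : ℝ} (h : ∀ k ≤ n + 1,
      (P ^ t *ᵥ below k) 0 - (P ^ t *ᵥ below k) (Fin.last n) ≤ η) : worstDist P π t ≤ η := by
  have hrows : ∀ x y : Fin (n + 1), x ≤ y → tvDist ((P ^ t) x) ((P ^ t) y) ≤ η := fun x y hxy => by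
    have hnn : ∀ i j, 0 ≤ (P ^ t) i j := fun _ _ =>
      Matrix.nonneg_of_mem_rowStochastic (pow_mem hP t)
    obtain ⟨k, hk, htv⟩ := exists_tvDist_eq_below (hnn x) (hnn y)
      (by rw [sum_pow_apply hP, sum_pow_apply hP]) fun j j' hj => hTP.pow t hxy hj
    have hanti := (hTP.pow t).mulVec_antitone (sum_pow_apply hP t) (below_antitone k)
    calc tvDist ((P ^ t) x) ((P ^ t) y) = (P ^ t *ᵥ below k) x - (P ^ t *ᵥ below k) y := htv
      _ ≤ (P ^ t *ᵥ below k) 0 - (P ^ t *ᵥ below k) (Fin.last n) :=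
        sub_le_sub (hanti (Fin.zero_le x)) (hanti (Fin.le_last y))
      _ ≤ η := h k hk
  refine hπ.worstDist_le fun x y => ?_
  rcases le_total x y with hxy | hxy
  · exact hrows x y hxy
  · exact (tvDist_comm _ _).trans_le (hrows y x hxy)

lemma IsBirthDeathChain.isTP2 (hBD : IsBirthDeathChain P) (hlazy : IsLazy P) : IsTP2 P := by
  have hnn : ∀ i j, 0 ≤ P i j := fun _ _ => Matrix.nonneg_of_mem_rowStochastic hBD.stochastic
  have hoff : ∀ i j, i ≠ j → P i j ≤ 1 / 2 := fun i j hij => by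
    have hpair : P i i + P i j ≤ ∑ k, P i k := by
      rw [← Finset.sum_pair hij]
      exact Finset.sum_le_sum_of_subset_of_nonneg (Finset.subset_univ _) fun k _ _ => hnn i k
    linarith [hlazy i, Matrix.sum_row_of_mem_rowStochastic hBD.stochastic i]
  intro i i' hi j j' hj
  rcases hi.eq_or_lt with rfl | hi
  · exact (mul_comm _ _).le
  rcases hj.eq_or_lt with rfl | hj
  · exact le_rfl
  have hdiag : 0 ≤ P i j * P i' j' := mul_nonneg (hnn _ _) (hnn _ _)
  rw [Fin.lt_def] at hi hj
  by_cases h₁ : (i : ℕ) + 1 < j'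
  · rwa [hBD.adjacent i j' (Or.inl h₁), zero_mul]
  by_cases h₂ : (j : ℕ) + 1 < i'
  · rwa [hBD.adjacent i' j (Or.inr h₂), mul_zero]
  obtain rfl : j = i := Fin.ext (by omega)
  obtain rfl : j' = i' := Fin.ext (by omega)
  have hne : j ≠ j' := Fin.ne_of_lt hj
  calc P j j' * P j' j ≤ 1 / 2 * (1 / 2) :=
        mul_le_mul (hoff _ _ hne) (hoff _ _ hne.symm) (hnn _ _) (by norm_num)
    _ ≤ P j j * P j' j' := mul_le_mul (hlazy _) (hlazy _) (by norm_num) (hnn _ _)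

end TP2Chain

section Cdf

variable {n : ℕ} {P : Matrix (Fin (n + 1)) (Fin (n + 1)) ℝ} {π : Fin (n + 1) → ℝ}

/-- The cumulative distribution function of `π`. With the strict inequality in `below` it is left
continuous: `cdf π k` is the mass of the states `0, …, k - 1`. -/
def cdf (π : Fin (n + 1) → ℝ) (k : ℕ) : ℝ := π ⬝ᵥ below k

lemma cdf_zero (π : Fin (n + 1) → ℝ) : cdf π 0 = 0 := by
  simp only [cdf, below, Nat.not_lt_zero, if_false, dotProduct, mul_zero, Finset.sum_const_zero]

lemma cdf_coe_succ (π : Fin (n + 1) → ℝ) (x : Fin (n + 1)) : cdf π (x + 1) = cdf π x + π x := by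
  have hbelow : (below (x + 1) : Fin (n + 1) → ℝ) = below x + Pi.single x 1 := by
    ext y
    simp only [below, Pi.add_apply, Pi.single_apply, Fin.ext_iff]
    split_ifs <;> first | omega | norm_num
  rw [cdf, hbelow, dotProduct_add, dotProduct_single_one, cdf]

section Simplex

variable (hπ : π ∈ stdSimplex ℝ (Fin (n + 1)))
include hπ

lemma cdf_mono : Monotone (cdf π) := fun _ _ h =>
  dotProduct_le_dotProduct_of_nonneg_left (below_mono h) hπ.1

lemma cdf_nonneg (k : ℕ) : 0 ≤ cdf π k :=
  dotProduct_nonneg_of_nonneg hπ.1 fun x => below_nonneg k x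

lemma cdf_top : cdf π (n + 1) = 1 := by
  rw [cdf, below_top, dotProduct_one, hπ.2]

lemma cdf_le_one (k : ℕ) : cdf π k ≤ 1 := by
  rw [← cdf_top hπ, cdf, cdf, below_top]
  exact dotProduct_le_dotProduct_of_nonneg_left (fun x => below_le_one k x) hπ.1

lemma exists_quantile {α : ℝ} (h₀ : 0 < α) (h₁ : α ≤ 1) :
    ∃ x : Fin (n + 1), cdf π x < α ∧ α ≤ cdf π (x + 1) := by
  have hex : ∃ k, α ≤ cdf π k := ⟨n + 1, h₁.trans_eq (cdf_top hπ).symm⟩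
  obtain ⟨j, hj⟩ : ∃ j, Nat.find hex = j + 1 := Nat.exists_eq_succ_of_ne_zero fun h0 => by
    have := Nat.find_spec hex
    rw [h0, cdf_zero] at this
    linarith
  have hle : Nat.find hex ≤ n + 1 := Nat.find_le (h₁.trans_eq (cdf_top hπ).symm)
  refine ⟨⟨j, by omega⟩, not_le.1 (Nat.find_min hex (by simp only; omega)), ?_⟩
  simpa only [hj] using Nat.find_spec hex

lemma cdf_comp_rev (k : ℕ) : cdf (π ∘ Fin.rev) k = 1 - cdf π (n + 1 - k) :=
  comp_rev_dotProduct_below hπ.2 k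

end Simplex

end Cdf

section BirthDeathStructure

variable {n : ℕ} {P : Matrix (Fin (n + 1)) (Fin (n + 1)) ℝ} {π : Fin (n + 1) → ℝ}

/-- An irreducible birth-and-death chain together with its stationary distribution. -/
structure IsIrreducibleBirthDeathChain (P : Matrix (Fin (n + 1)) (Fin (n + 1)) ℝ)
    (π : Fin (n + 1) → ℝ) : Prop extends IsBirthDeathChain P where
  irreducible : P.IsIrreducible
  stationary : IsStationaryDistribution P π

/-- The conductance `π (j) P (j, j + 1)` of the edge between `j` and `j + 1`. It is indexed by the
lower endpoint and vanishes for `j ≥ n`, where there is no edge. -/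
def conductance (P : Matrix (Fin (n + 1)) (Fin (n + 1)) ℝ) (π : Fin (n + 1) → ℝ) (j : ℕ) : ℝ :=
  if h : j < n then π ⟨j, by omega⟩ * P ⟨j, by omega⟩ ⟨j + 1, by omega⟩ else 0

lemma conductance_eq {x y : Fin (n + 1)} (h : (y : ℕ) = x + 1) :
    conductance P π x = π x * P x y := by
  rw [conductance, dif_pos (by omega)]
  exact congrArg (π x * P x ·) (Fin.ext h.symm)

lemma conductance_of_le {j : ℕ} (h : n ≤ j) : conductance P π j = 0 :=
  dif_neg h.not_gt

lemma sum_ite_coe_eq (j : ℕ) (a : ℝ) :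
    ∑ y : Fin (n + 1), (if (y : ℕ) = j then a else 0) = if j ≤ n then a else 0 := by
  rw [Fin.sum_univ_eq_sum_range (fun i => if i = j then a else 0), Finset.sum_ite_eq']
  simp only [Finset.mem_range, Nat.lt_succ_iff]

/-- In stationarity the net flow across the edge `{x, y}` vanishes, since `x` and `y` are the only
states connecting `{0, …, x}` to its complement. -/
lemma IsBirthDeathChain.balance_of_eq_add_one (hBD : IsBirthDeathChain P)
    (hπ : IsStationaryDistribution P π) {x y : Fin (n + 1)} (h : (y : ℕ) = x + 1) :
    π x * P x y = π y * P y x := by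
  have hflow : ∑ i, ∑ j, π i * P i j * (below y i - below y j) = 0 := by
    have hinv : π ⬝ᵥ (P *ᵥ below y) = π ⬝ᵥ below y := by rw [Matrix.dotProduct_mulVec, hπ.2]
    rw [← sub_eq_zero.2 hinv.symm, dotProduct, dotProduct, ← Finset.sum_sub_distrib]
    refine Finset.sum_congr rfl fun i _ => ?_
    simp only [mul_sub, Finset.sum_sub_distrib, mul_assoc, ← Finset.mul_sum, ← Finset.sum_mul,
      Matrix.sum_row_of_mem_rowStochastic hBD.stochastic, one_mul]
    rfl
  have hcross : ∀ i j, π i * P i j * (below y i - below y j) =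
      (if i = x then if j = y then π x * P x y else 0 else 0) -
        if i = y then if j = x then π y * P y x else 0 else 0 := by
    intro i j
    by_cases hup : i = x ∧ j = y
    · obtain ⟨rfl, rfl⟩ := hup
      simp [below, h, Fin.ext_iff]
    by_cases hdown : i = y ∧ j = x
    · obtain ⟨rfl, rfl⟩ := hdown
      simp [below, h, Fin.ext_iff]
    rw [← ite_and, ← ite_and, if_neg hup, if_neg hdown, sub_zero]
    by_cases hadj : (i : ℕ) + 1 < j ∨ (j : ℕ) + 1 < i
    · rw [hBD.adjacent i j hadj, mul_zero, zero_mul]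
    · rw [Fin.ext_iff, Fin.ext_iff] at hup hdown
      simp only [below]
      split_ifs <;> first | omega | ring
  simp only [hcross, Finset.sum_sub_distrib, Finset.sum_ite_eq', Finset.mem_univ, if_true,
    Finset.sum_ite_irrel, Finset.sum_const_zero] at hflow
  exact sub_eq_zero.1 hflow

namespace IsIrreducibleBirthDeathChain

variable (C : IsIrreducibleBirthDeathChain P π)
include C

lemma pos (x : Fin (n + 1)) : 0 < π x := C.stationary.pos C.irreducible x

lemma nonneg (x y : Fin (n + 1)) : 0 ≤ P x y := C.irreducible.nonneg x y

lemma sum_row (x : Fin (n + 1)) : ∑ y, P x y = 1 :=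
  Matrix.sum_row_of_mem_rowStochastic C.stochastic x

lemma isReversible : IsReversible P π := fun x y => by
  rcases lt_trichotomy ((x : ℕ) + 1) y with h | h | h
  · rw [C.adjacent x y (Or.inl h), C.adjacent y x (Or.inr h), mul_zero, mul_zero]
  · exact C.balance_of_eq_add_one C.stationary h.symm
  rcases lt_trichotomy ((y : ℕ) + 1) x with h' | h' | h'
  · rw [C.adjacent x y (Or.inr h'), C.adjacent y x (Or.inl h'), mul_zero, mul_zero]
  · exact (C.balance_of_eq_add_one C.stationary h'.symm).symm
  · obtain rfl : x = y := Fin.ext (by omega)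
    rfl

/-- If the edge `{x, y}` could not be crossed upwards, then by reversibility it could not be
crossed downwards either, and the indicator of `{0, …, x}` would be harmonic. -/
lemma apply_pos_of_eq_add_one {x y : Fin (n + 1)} (h : (y : ℕ) = x + 1) : 0 < P x y := by
  refine (C.nonneg x y).lt_of_ne fun h₀ => ?_
  have h₀' : P y x = 0 := by
    have := C.isReversible x y
    rw [← h₀, mul_zero] at this
    exact (mul_eq_zero.1 this.symm).resolve_left (C.pos y).ne'
  have hcut : ∀ i j, P i j * (below y j - below y i) = 0 := by
    intro i j
    by_cases hadj : (i : ℕ) + 1 < j ∨ (j : ℕ) + 1 < i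
    · rw [C.adjacent i j hadj, zero_mul]
    · simp only [below]
      split_ifs
      · ring
      · rw [show i = y from Fin.ext (by omega), show j = x from Fin.ext (by omega), h₀', zero_mul]
      · rw [show i = x from Fin.ext (by omega), show j = y from Fin.ext (by omega), ← h₀, zero_mul]
      · ring
  have hharm : P *ᵥ below y = below y := by
    ext i
    have hsum : ∑ j, P i j * (below y j - below y i) = 0 :=
      Finset.sum_eq_zero fun j _ => hcut i j
    simp only [mul_sub, Finset.sum_sub_distrib, ← Finset.sum_mul, C.sum_row, one_mul] at hsum
    exact sub_eq_zero.1 hsum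
  have := eq_of_mulVec_eq_self C.stochastic C.irreducible hharm x y
  simp [below, h] at this

lemma conductance_nonneg (j : ℕ) : 0 ≤ conductance P π j := by
  rw [conductance]
  split_ifs
  exacts [mul_nonneg (C.pos _).le (C.nonneg _ _), le_rfl]

lemma conductance_pos {j : ℕ} (h : j < n) : 0 < conductance P π j := by
  rw [conductance, dif_pos h]
  exact mul_pos (C.pos _) (C.apply_pos_of_eq_add_one rfl)

lemma conductance_eq_of_add_one {x y : Fin (n + 1)} (h : (y : ℕ) + 1 = x) :
    conductance P π y = π x * P x y := by
  rw [conductance_eq h.symm, C.isReversible]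

lemma mul_mulVec_of_eq_zero (φ : ℕ → ℝ) (x : Fin (n + 1)) (hx : φ x = 0) :
    π x * (P *ᵥ fun y => φ y) x =
      conductance P π x * φ (x + 1) + conductance P π (x - 1) * φ (x - 1) := by
  have hterm : ∀ y : Fin (n + 1), π x * (P x y * φ y) =
      (if (y : ℕ) = x + 1 then conductance P π x * φ (x + 1) else 0) +
        if (y : ℕ) = x - 1 then conductance P π (x - 1) * φ (x - 1) else 0 := by
    intro y
    by_cases hup : (y : ℕ) = x + 1
    · rw [if_pos hup, if_neg (by omega), conductance_eq hup, ← hup]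
      ring
    by_cases hself : (y : ℕ) = x
    · have hdown : (y : ℕ) = x - 1 → φ (x - 1) = 0 := fun h => by rw [← h, hself, hx]
      rw [if_neg hup, hself, hx]
      split_ifs with h
      · rw [hdown (hself.trans h)]; ring
      · ring
    by_cases hdown : (y : ℕ) + 1 = x
    · rw [if_neg hup, if_pos (by omega), show (x : ℕ) - 1 = y by omega,
        C.conductance_eq_of_add_one hdown]
      ring
    · rw [if_neg hup, if_neg (by omega), C.adjacent x y (by omega)]
      ring
  rw [Matrix.mulVec, dotProduct, Finset.mul_sum, Finset.sum_congr rfl fun y _ => hterm y,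
    Finset.sum_add_distrib, sum_ite_coe_eq, sum_ite_coe_eq, if_pos (by omega : (x : ℕ) - 1 ≤ n)]
  congr 1
  split_ifs with h
  · rfl
  · rw [conductance_of_le (by omega), zero_mul]

lemma mulVec_sub_const (f : Fin (n + 1) → ℝ) (c : ℝ) (x : Fin (n + 1)) :
    (P *ᵥ fun y => f y - c) x = (P *ᵥ f) x - c := by
  simp only [Matrix.mulVec, dotProduct, mul_sub, Finset.sum_sub_distrib, ← Finset.sum_mul,
    C.sum_row, one_mul]

lemma mul_mulVec_sub (u : ℕ → ℝ) (x : Fin (n + 1)) :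
    π x * ((P *ᵥ fun y => u y) x - u x) =
      conductance P π x * (u (x + 1) - u x) - conductance P π (x - 1) * (u x - u (x - 1)) := by
  rw [← C.mulVec_sub_const, C.mul_mulVec_of_eq_zero (fun j => u j - u x) x (sub_self _)]
  ring

end IsIrreducibleBirthDeathChain

end BirthDeathStructure

section Reflection

variable {n : ℕ} {P : Matrix (Fin (n + 1)) (Fin (n + 1)) ℝ} {π : Fin (n + 1) → ℝ}

lemma pow_submatrix_rev (P : Matrix (Fin (n + 1)) (Fin (n + 1)) ℝ) (t : ℕ) :
    P.submatrix Fin.rev Fin.rev ^ t = (P ^ t).submatrix Fin.rev Fin.rev :=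
  (map_pow (Matrix.reindexAlgEquiv ℝ ℝ Fin.revPerm) P t).symm

lemma submatrix_rev_mulVec (f : Fin (n + 1) → ℝ) :
    P.submatrix Fin.rev Fin.rev *ᵥ f = (P *ᵥ (f ∘ Fin.rev)) ∘ Fin.rev :=
  Matrix.submatrix_mulVec_equiv P f Fin.rev Fin.revPerm

lemma HasPoincare.rev {R : ℝ} (h : HasPoincare P π R) :
    HasPoincare (P.submatrix Fin.rev Fin.rev) (π ∘ Fin.rev) R := fun f => by
  have hmean : (π ∘ Fin.rev) ⬝ᵥ f = π ⬝ᵥ (f ∘ Fin.rev) :=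
    comp_equiv_symm_dotProduct π f Fin.revPerm
  convert h (f ∘ Fin.rev) using 1
  · rw [← Equiv.sum_comp Fin.revPerm, hmean]
    simp
  · rw [dirichletForm, dirichletForm, ← Equiv.sum_comp Fin.revPerm, submatrix_rev_mulVec]
    simp

lemma IsIrreducibleBirthDeathChain.rev (C : IsIrreducibleBirthDeathChain P π) :
    IsIrreducibleBirthDeathChain (P.submatrix Fin.rev Fin.rev) (π ∘ Fin.rev) where
  stochastic :=
    Matrix.reindex_mem_rowStochastic (e₁ := Fin.revPerm) (e₂ := Fin.revPerm) C.stochastic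
  adjacent i j h := C.adjacent _ _ (by simp only [Fin.val_rev]; omega)
  irreducible := by
    refine (Matrix.isIrreducible_iff_exists_pow_pos
      (A := P.submatrix Fin.rev Fin.rev) fun i j => C.nonneg _ _).2 fun i j => ?_
    obtain ⟨k, hk, hpos⟩ :=
      (Matrix.isIrreducible_iff_exists_pow_pos C.nonneg).1 C.irreducible i.rev j.rev
    exact ⟨k, hk, by rwa [pow_submatrix_rev]⟩
  stationary := by
    refine ⟨⟨fun x => (C.pos _).le, (Equiv.sum_comp Fin.revPerm π).trans C.stationary.1.2⟩, ?_⟩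
    have h := Matrix.submatrix_vecMul_equiv P (π ∘ Fin.rev) Fin.revPerm Fin.rev
    rwa [show (π ∘ Fin.rev) ∘ Fin.revPerm.symm = π by ext; simp, C.stationary.2] at h

lemma tvDist_submatrix_rev (P : Matrix (Fin (n + 1)) (Fin (n + 1)) ℝ) (π : Fin (n + 1) → ℝ)
    (t : ℕ) (x : Fin (n + 1)) :
    tvDist ((P.submatrix Fin.rev Fin.rev ^ t) x) (π ∘ Fin.rev) = tvDist ((P ^ t) x.rev) π := by
  rw [pow_submatrix_rev]
  exact tvDist_comp_equiv Fin.revPerm ((P ^ t) x.rev) π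

end Reflection

section Potential

variable {n : ℕ} {P : Matrix (Fin (n + 1)) (Fin (n + 1)) ℝ} {π : Fin (n + 1) → ℝ}

/-- The function vanishing on `{m, m + 1, …}` whose decrement along the edge from `x` to `x + 1`
carries the current `a (x + 1)`. With the unit current it is a resistance; with the currents `cdf π`
and `hitEnergy P π` it gives the mean and the variance of a hitting time. -/
noncomputable def potential (P : Matrix (Fin (n + 1)) (Fin (n + 1)) ℝ) (π : Fin (n + 1) → ℝ)
    (a : ℕ → ℝ) (m x : ℕ) : ℝ :=
  ∑ i ∈ Finset.Ico x m, a (i + 1) / conductance P π i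

lemma potential_of_le {a : ℕ → ℝ} {m x : ℕ} (h : m ≤ x) : potential P π a m x = 0 := by
  rw [potential, Finset.Ico_eq_empty_of_le h, Finset.sum_empty]

lemma potential_of_lt {a : ℕ → ℝ} {m x : ℕ} (h : x < m) :
    potential P π a m x = a (x + 1) / conductance P π x + potential P π a m (x + 1) :=
  Finset.sum_eq_sum_Ico_succ_bot h _

namespace IsIrreducibleBirthDeathChain

variable (C : IsIrreducibleBirthDeathChain P π)
include C

lemma potential_nonneg {a : ℕ → ℝ} (ha : ∀ i, 0 ≤ a i) (m x : ℕ) : 0 ≤ potential P π a m x :=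
  Finset.sum_nonneg fun _ _ => div_nonneg (ha _) (C.conductance_nonneg _)

lemma potential_antitone {a : ℕ → ℝ} (ha : ∀ i, 0 ≤ a i) (m : ℕ) :
    Antitone (potential P π a m) := fun _ _ h =>
  Finset.sum_le_sum_of_subset_of_nonneg (Finset.Ico_subset_Ico_left h) fun _ _ _ =>
    div_nonneg (ha _) (C.conductance_nonneg _)

lemma conductance_mul_potential_sub (a : ℕ → ℝ) {m x : ℕ} (hx : x < m) (hm : m ≤ n) :
    conductance P π x * (potential P π a m x - potential P π a m (x + 1)) = a (x + 1) := by
  rw [potential_of_lt hx, add_sub_cancel_right,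
    mul_div_cancel₀ _ (C.conductance_pos (hx.trans_le hm)).ne']

lemma mul_mulVec_potential_sub {a : ℕ → ℝ} (ha : a 0 = 0) {m : ℕ} (hm : m ≤ n)
    {x : Fin (n + 1)} (hx : (x : ℕ) < m) :
    π x * ((P *ᵥ fun y => potential P π a m y) x - potential P π a m x) = a x - a (x + 1) := by
  have hin :
      conductance P π (x - 1) * (potential P π a m x - potential P π a m (x - 1)) = -a x := by
    rcases Nat.eq_zero_or_pos (x : ℕ) with h | h
    · rw [h, ha, sub_self, mul_zero, neg_zero]
    · have := C.conductance_mul_potential_sub a (x := (x : ℕ) - 1) (by omega) hm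
      rw [Nat.sub_add_cancel h] at this
      linarith
  have hout := C.conductance_mul_potential_sub a hx hm
  rw [C.mul_mulVec_sub, hin]
  linarith

end IsIrreducibleBirthDeathChain

end Potential

section HittingTime

variable {n : ℕ} {P : Matrix (Fin (n + 1)) (Fin (n + 1)) ℝ} {π : Fin (n + 1) → ℝ}

/-- The expected hitting time of `m` from `x`, which vanishes for `m ≤ x`. -/
noncomputable def hitMean (P : Matrix (Fin (n + 1)) (Fin (n + 1)) ℝ) (π : Fin (n + 1) → ℝ)
    (m x : ℕ) : ℝ :=
  potential P π (cdf π) m x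

/-- The stationary mean, restricted to the states below `i`, of the squared increment of `hitMean`
in one step. For `j = 0` the second summand vanishes since `cdf π 0 = 0`. -/
noncomputable def hitEnergy (P : Matrix (Fin (n + 1)) (Fin (n + 1)) ℝ) (π : Fin (n + 1) → ℝ)
    (i : ℕ) : ℝ :=
  ∑ j ∈ Finset.range i,
    (cdf π (j + 1) ^ 2 / conductance P π j + cdf π j ^ 2 / conductance P π (j - 1))

/-- The variance of the hitting time of `m` from `x`, that is, the expected quadratic variation up
to that time of the martingale `t + hitMean P π m (X t)`. -/
noncomputable def hitVar (P : Matrix (Fin (n + 1)) (Fin (n + 1)) ℝ) (π : Fin (n + 1) → ℝ)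
    (m x : ℕ) : ℝ :=
  potential P π (hitEnergy P π) m x

namespace IsIrreducibleBirthDeathChain

variable (C : IsIrreducibleBirthDeathChain P π)
include C

lemma hitMean_nonneg (m x : ℕ) : 0 ≤ hitMean P π m x :=
  C.potential_nonneg (cdf_nonneg C.stationary.1) m x

lemma hitMean_antitone (m : ℕ) : Antitone (hitMean P π m) :=
  C.potential_antitone (cdf_nonneg C.stationary.1) m

lemma hitEnergy_nonneg (i : ℕ) : 0 ≤ hitEnergy P π i :=
  Finset.sum_nonneg fun _ _ => add_nonneg (div_nonneg (sq_nonneg _) (C.conductance_nonneg _))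
    (div_nonneg (sq_nonneg _) (C.conductance_nonneg _))

lemma hitVar_nonneg (m x : ℕ) : 0 ≤ hitVar P π m x := C.potential_nonneg C.hitEnergy_nonneg m x

lemma mulVec_hitMean {m : ℕ} (hm : m ≤ n) {x : Fin (n + 1)} (hx : (x : ℕ) < m) :
    (P *ᵥ fun y => hitMean P π m y) x = hitMean P π m x - 1 := by
  have h := C.mul_mulVec_potential_sub (cdf_zero π) hm hx
  rw [cdf_coe_succ, sub_add_cancel_left, ← mul_neg_one, mul_right_inj' (C.pos x).ne'] at h
  exact (sub_eq_iff_eq_add'.1 h).trans (sub_eq_add_neg _ _).symm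

lemma mul_mulVec_sq_hitMean_sub {m : ℕ} (hm : m ≤ n) {x : Fin (n + 1)} (hx : (x : ℕ) < m) :
    π x * (P *ᵥ fun y => (hitMean P π m y - hitMean P π m x) ^ 2) x =
      cdf π (x + 1) ^ 2 / conductance P π x + cdf π x ^ 2 / conductance P π (x - 1) := by
  have hedge : ∀ j < m, conductance P π j * (hitMean P π m j - hitMean P π m (j + 1)) ^ 2 =
      cdf π (j + 1) ^ 2 / conductance P π j := fun j hj => by
    rw [← C.conductance_mul_potential_sub (cdf π) hj hm,
      eq_div_iff (C.conductance_pos (hj.trans_le hm)).ne', hitMean, hitMean]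
    ring
  rw [C.mul_mulVec_of_eq_zero (fun j => (hitMean P π m j - hitMean P π m x) ^ 2) x (by simp),
    ← hedge x hx, sub_sq_comm]
  congr 1
  rcases Nat.eq_zero_or_pos (x : ℕ) with h | h
  · simp [h, cdf_zero]
  · have := hedge ((x : ℕ) - 1) (by omega)
    rwa [Nat.sub_add_cancel h] at this

lemma mulVec_hitVar_add {m : ℕ} (hm : m ≤ n) {x : Fin (n + 1)} (hx : (x : ℕ) < m) :
    (P *ᵥ fun y => hitVar P π m y) x +
      (P *ᵥ fun y => (hitMean P π m y - hitMean P π m x) ^ 2) x = hitVar P π m x := by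
  have h := C.mul_mulVec_potential_sub (a := hitEnergy P π) (Finset.sum_range_zero _) hm hx
  rw [hitEnergy, hitEnergy, Finset.sum_range_succ, sub_add_cancel_left,
    ← C.mul_mulVec_sq_hitMean_sub hm hx, ← mul_neg, mul_right_inj' (C.pos x).ne'] at h
  exact eq_sub_iff_add_eq.1 ((sub_eq_iff_eq_add'.1 h).trans (sub_eq_add_neg _ _).symm)

lemma mulVec_sq_add_hitVar {m : ℕ} (hm : m ≤ n) {x : Fin (n + 1)} (hx : (x : ℕ) < m) (s : ℝ) :
    (P *ᵥ fun y => (s + 1 + hitMean P π m y) ^ 2 + hitVar P π m y) x ≤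
      (s + hitMean P π m x) ^ 2 + hitVar P π m x := by
  set a := s + 1 + hitMean P π m x
  have hexpand : ∀ y : Fin (n + 1), (s + 1 + hitMean P π m y) ^ 2 + hitVar P π m y =
      a ^ 2 + 2 * a * (hitMean P π m y - hitMean P π m x) +
        (hitVar P π m y + (hitMean P π m y - hitMean P π m x) ^ 2) := fun y => by
    simp only [a]; ring
  have hmean : ∑ y, P x y * (hitMean P π m y - hitMean P π m x) = -1 := by
    simp only [mul_sub, Finset.sum_sub_distrib, ← Finset.sum_mul, C.sum_row, one_mul]
    exact (sub_eq_iff_eq_add.2 ((C.mulVec_hitMean hm hx).trans (by ring)))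
  have hvar := C.mulVec_hitVar_add hm hx
  simp only [Matrix.mulVec, dotProduct] at hvar ⊢
  simp only [hexpand, mul_add (P x _), Finset.sum_add_distrib, ← Finset.sum_mul, C.sum_row,
    mul_left_comm (P x _) (2 * a), ← Finset.mul_sum, hmean]
  rw [hvar]
  simp only [a]
  linarith

lemma pow_mulVec_zero_le_hitVar {m : ℕ} (hm : m ≤ n) {f : Fin (n + 1) → ℝ} {t : ℕ}
    (hinit : ∀ x : Fin (n + 1), (x : ℕ) < m → f x ≤ (t - hitMean P π m 0 + hitMean P π m x) ^ 2)
    (hoff : ∀ s : ℕ, ∀ x : Fin (n + 1), m ≤ (x : ℕ) →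
      (P ^ s *ᵥ f) x ≤ (t - hitMean P π m 0 - s) ^ 2) :
    (P ^ t *ᵥ f) 0 ≤ hitVar P π m 0 := by
  set u : ℕ → Fin (n + 1) → ℝ := fun s x =>
    (t - hitMean P π m 0 - s + hitMean P π m x) ^ 2 + hitVar P π m x with hu
  have hoff' : ∀ s, ∀ x : Fin (n + 1), m ≤ (x : ℕ) → (P ^ s *ᵥ f) x ≤ u s x := fun s x hx => by
    rw [hu]
    simp only [hitMean, hitVar, potential_of_le hx, add_zero]
    exact hoff s x hx
  have hle := pow_mulVec_le_of_supersolution C.nonneg {x : Fin (n + 1) | (x : ℕ) < m} (u := u)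
    (f := f) (fun x => ?_) (fun s x hx => ?_) (fun s x hx => hoff' s x (not_lt.1 hx)) t 0
  · simpa [hu] using hle
  · rcases lt_or_ge (x : ℕ) m with hx | hx
    · simp only [hu, Nat.cast_zero, sub_zero]
      exact (hinit x hx).trans (le_add_of_nonneg_right (C.hitVar_nonneg m x))
    · simpa using hoff' 0 x hx
  · have hstep := C.mulVec_sq_add_hitVar hm hx (t - hitMean P π m 0 - (s + 1 : ℕ))
    refine le_of_eq_of_le ?_ hstep
    push_cast
    simp only [hu, sub_add_eq_sub_sub, sub_add_cancel]

lemma pow_mulVec_below_nonneg (t k : ℕ) (x : Fin (n + 1)) : 0 ≤ (P ^ t *ᵥ below k) x :=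
  dotProduct_nonneg_of_nonneg (Matrix.pow_apply_nonneg C.nonneg t x) fun y => below_nonneg k y

lemma pow_mulVec_below_le_one (t k : ℕ) (x : Fin (n + 1)) : (P ^ t *ᵥ below k) x ≤ 1 := by
  rw [← sum_pow_apply C.stochastic t x, ← dotProduct_one]
  exact dotProduct_le_dotProduct_of_nonneg_left (fun y => below_le_one k y)
    (Matrix.pow_apply_nonneg C.nonneg t x)

lemma pow_mulVec_smul_sub_const (t : ℕ) (a c : ℝ) (f : Fin (n + 1) → ℝ) (x : Fin (n + 1)) :
    (P ^ t *ᵥ fun y => a * (f y - c)) x = a * ((P ^ t *ᵥ f) x - c) := by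
  simp only [Matrix.mulVec, dotProduct, mul_left_comm _ a, ← Finset.mul_sum, mul_sub,
    Finset.sum_sub_distrib, ← Finset.sum_mul, sum_pow_apply C.stochastic, one_mul]

lemma hitMean_mul_le {m : ℕ} (hm : m ≤ n) (t : ℕ) :
    hitMean P π m 0 * (1 - (P ^ t *ᵥ below m) 0) ≤ t := by
  have hle := pow_mulVec_le_of_supersolution C.nonneg {x : Fin (n + 1) | (x : ℕ) < m}
    (f := -hitMean P π m 0 • below m) (u := fun s x => s - hitMean P π m x) (fun x => ?_)
    (fun s x hx => ?_) (fun s x hx => ?_) t 0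
  · rw [Matrix.mulVec_smul, Pi.smul_apply, smul_eq_mul] at hle
    simp only [Fin.val_zero] at hle
    linarith
  · simp only [Pi.smul_apply, smul_eq_mul, Nat.cast_zero, zero_sub, below, neg_mul]
    split_ifs with hx
    · simpa only [mul_one, neg_le_neg_iff] using C.hitMean_antitone m (Nat.zero_le x)
    · simp only [mul_zero, hitMean, potential_of_le (not_lt.1 hx), le_refl]
  · have hstep := C.mulVec_hitMean hm hx
    simp only [Matrix.mulVec, dotProduct, mul_sub, Finset.sum_sub_distrib, ← Finset.sum_mul,
      C.sum_row, one_mul, Nat.cast_add, Nat.cast_one] at hstep ⊢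
    linarith
  · simp only [hitMean, potential_of_le (not_lt.1 hx), sub_zero, Matrix.mulVec_smul, Pi.smul_apply,
      smul_eq_mul]
    exact (mul_nonpos_of_nonpos_of_nonneg (neg_nonpos.2 (C.hitMean_nonneg m 0))
      (C.pow_mulVec_below_nonneg s m x)).trans (Nat.cast_nonneg s)

lemma pow_mulVec_below_le_cdf_add (hTP : IsTP2 P) (t k : ℕ) (x : Fin (n + 1)) :
    (P ^ t *ᵥ below k) x ≤ cdf π k + (1 - cdf π (x + 1)) := by
  have hanti : Antitone (P ^ t *ᵥ below k) :=
    (hTP.pow t).mulVec_antitone (sum_pow_apply C.stochastic t) (below_antitone k)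
  have hmass : cdf π (x + 1) * (P ^ t *ᵥ below k) x ≤ cdf π k := by
    have hk : ∑ y, π y * (P ^ t *ᵥ below k) y = cdf π k := C.stationary.dotProduct_pow_mulVec t _
    rw [← hk, cdf, dotProduct, Finset.sum_mul]
    refine Finset.sum_le_sum fun y _ => ?_
    rw [mul_assoc]
    refine mul_le_mul_of_nonneg_left ?_ (C.pos y).le
    rw [below]
    split_ifs with h
    · simpa only [one_mul] using hanti (Fin.le_def.2 (Nat.lt_succ_iff.1 h))
    · simpa only [zero_mul] using C.pow_mulVec_below_nonneg t k y
  have hone := mul_le_mul_of_nonneg_left (C.pow_mulVec_below_le_one t k x)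
    (sub_nonneg.2 (cdf_le_one C.stationary.1 (x + 1)))
  linarith

lemma pow_mulVec_below_zero_sub_cdf_le (hTP : IsTP2 P) {m : ℕ} (hm : m ≤ n) {A : ℝ} (hA : 0 < A)
    {t : ℕ} (ht : hitMean P π m 0 + A ≤ t) (k : ℕ) :
    (P ^ t *ᵥ below k) 0 - cdf π k ≤ hitVar P π m 0 / A ^ 2 + (1 - cdf π (m + 1)) := by
  set ρ := cdf π k + (1 - cdf π (m + 1))
  have hρ₀ : 0 ≤ ρ := add_nonneg (cdf_nonneg C.stationary.1 k)
    (sub_nonneg.2 (cdf_le_one C.stationary.1 _))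
  have hbound := C.pow_mulVec_zero_le_hitVar hm (f := fun y => A ^ 2 * (below k y - ρ)) (t := t)
    (fun x _ => ?_) (fun s x hx => ?_)
  · rw [C.pow_mulVec_smul_sub_const, mul_comm, ← le_div_iff₀ (by positivity)] at hbound
    linarith
  · calc A ^ 2 * (below k x - ρ) ≤ A ^ 2 * 1 :=
          mul_le_mul_of_nonneg_left (by linarith [below_le_one k x]) (sq_nonneg A)
      _ ≤ (t - hitMean P π m 0 + hitMean P π m x) ^ 2 := by
          rw [mul_one]
          exact pow_le_pow_left₀ hA.le (by linarith [C.hitMean_nonneg m x]) 2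
  · rw [C.pow_mulVec_smul_sub_const]
    refine (mul_nonpos_of_nonneg_of_nonpos (sq_nonneg A) ?_).trans (sq_nonneg _)
    linarith [C.pow_mulVec_below_le_cdf_add hTP s k x,
      cdf_mono C.stationary.1 (Nat.add_le_add_right hx 1)]

lemma one_sub_cdf_sub_le_tvDist {m : ℕ} (hm : m ≤ n) {A : ℝ} (hA : 0 < A) {t : ℕ}
    (ht : t ≤ hitMean P π m 0 - A) :
    1 - cdf π m - hitVar P π m 0 / A ^ 2 ≤ tvDist ((P ^ t) 0) π := by
  have hbound := C.pow_mulVec_zero_le_hitVar hm (f := fun y => -A ^ 2 * (below m y - 1)) (t := t)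
    (fun x hx => ?_) (fun s x _ => ?_)
  · rw [C.pow_mulVec_smul_sub_const] at hbound
    have hearly : 1 - (P ^ t *ᵥ below m) 0 ≤ hitVar P π m 0 / A ^ 2 := by
      rw [le_div_iff₀ (by positivity)]
      linarith
    have hdist : (P ^ t *ᵥ below m) 0 - cdf π m ≤ tvDist ((P ^ t) 0) π :=
      dotProduct_sub_dotProduct_le_tvDist ((sum_pow_apply C.stochastic t 0).trans
        C.stationary.1.2.symm) (below_nonneg m) (below_le_one m)
    linarith
  · rw [below, if_pos hx, sub_self, mul_zero]
    exact sq_nonneg _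
  · rw [C.pow_mulVec_smul_sub_const]
    calc -A ^ 2 * ((P ^ s *ᵥ below m) x - 1) ≤ A ^ 2 := by
          nlinarith [mul_nonneg (sq_nonneg A) (C.pow_mulVec_below_nonneg s m x)]
      _ ≤ (-(t - hitMean P π m 0 - s)) ^ 2 :=
          pow_le_pow_left₀ hA.le (by linarith [Nat.cast_nonneg (α := ℝ) s]) 2
      _ = (t - hitMean P π m 0 - s) ^ 2 := neg_sq _

lemma exists_forall_pow_mulVec_below_sub_cdf_le (hTP : IsTP2 P) {η : ℝ} (hη : 0 < η) :
    ∃ T : ℕ, ∀ t ≥ T, ∀ k, (P ^ t *ᵥ below k) 0 - cdf π k ≤ η := by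
  set A := max 1 (hitVar P π n 0 / η)
  have hA : 1 ≤ A := le_max_left _ _
  obtain ⟨T, hT⟩ := exists_nat_ge (hitMean P π n 0 + A)
  refine ⟨T, fun t ht k => ?_⟩
  have hlate := C.pow_mulVec_below_zero_sub_cdf_le hTP le_rfl (zero_lt_one.trans_le hA)
    (hT.trans (Nat.cast_le.2 ht)) k
  have hvar : hitVar P π n 0 / A ^ 2 ≤ η := by
    rw [div_le_iff₀ (by positivity)]
    have hle : hitVar P π n 0 ≤ A * η := (div_le_iff₀ hη).1 (le_max_right _ _)
    nlinarith [mul_nonneg hη.le (zero_le_one.trans hA)]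
  rw [cdf_top C.stationary.1, sub_self, add_zero] at hlate
  exact hlate.trans hvar

lemma worstDist_le_add (hTP : IsTP2 P) {t : ℕ} {η η' : ℝ}
    (h : ∀ k, (P ^ t *ᵥ below k) 0 - cdf π k ≤ η)
    (h' : ∀ k, (P.submatrix Fin.rev Fin.rev ^ t *ᵥ below k) 0 - cdf (π ∘ Fin.rev) k ≤ η') :
    worstDist P π t ≤ η + η' := by
  refine hTP.worstDist_le C.stochastic C.stationary fun k hk => ?_
  have hright := h' (n + 1 - k)
  have hrow : (P.submatrix Fin.rev Fin.rev ^ t) 0 = (P ^ t) (Fin.last n) ∘ Fin.rev := by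
    rw [pow_submatrix_rev, ← Fin.rev_zero]
    rfl
  rw [cdf_comp_rev C.stationary.1, Matrix.mulVec, hrow,
    comp_rev_dotProduct_below (sum_pow_apply C.stochastic t _), Nat.sub_sub_self hk] at hright
  have hleft := h k
  simp only [Matrix.mulVec] at hleft ⊢
  linarith

lemma exists_worstDist_le (hTP : IsTP2 P) {η : ℝ} (hη : 0 < η) : ∃ t, worstDist P π t ≤ η := by
  obtain ⟨T, hT⟩ := C.exists_forall_pow_mulVec_below_sub_cdf_le hTP (half_pos hη)
  obtain ⟨T', hT'⟩ := C.rev.exists_forall_pow_mulVec_below_sub_cdf_le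
    (hTP.submatrix_antitone Fin.rev_anti Fin.rev_anti) (half_pos hη)
  exact ⟨max T T', (C.worstDist_le_add hTP (hT _ (le_max_left T T'))
    (hT' _ (le_max_right T T'))).trans_eq (add_halves η)⟩

end IsIrreducibleBirthDeathChain

end HittingTime

section Resistance

variable {n : ℕ} {P : Matrix (Fin (n + 1)) (Fin (n + 1)) ℝ} {π : Fin (n + 1) → ℝ}

/-- The effective resistance between `x` and `m`, which is zero for `m ≤ x`. -/
noncomputable def resist (P : Matrix (Fin (n + 1)) (Fin (n + 1)) ℝ) (π : Fin (n + 1) → ℝ)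
    (m x : ℕ) : ℝ :=
  potential P π 1 m x

/-- The unit current from `i` to the right: its potential is `resist P π m` stopped at `i`. -/
def unitCurrent (i j : ℕ) : ℝ :=
  if i < j then 1 else 0

lemma potential_unitCurrent_of_le {i m x : ℕ} (hx : x ≤ i) (hi : i ≤ m) :
    potential P π (unitCurrent i) m x = resist P π m i := by
  rw [potential, ← Finset.sum_Ico_consecutive _ hx hi, Finset.sum_eq_zero fun j hj => ?_, zero_add]
  · refine Finset.sum_congr rfl fun j hj => ?_
    rw [unitCurrent, if_pos (Nat.lt_succ_of_le (Finset.mem_Ico.1 hj).1), Pi.one_apply]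
  · rw [unitCurrent, if_neg (Nat.not_lt.2 (Finset.mem_Ico.1 hj).2), zero_div]

lemma cdf_mul_sq_add_le (hπ : π ∈ stdSimplex ℝ (Fin (n + 1))) {f : Fin (n + 1) → ℝ} {k m : ℕ}
    (hkm : k ≤ m) {G : ℝ} (hlow : ∀ x : Fin (n + 1), (x : ℕ) < k → f x = G)
    (hhigh : ∀ x : Fin (n + 1), m ≤ (x : ℕ) → f x = 0) (c : ℝ) :
    cdf π k * (G - c) ^ 2 + (1 - cdf π m) * c ^ 2 ≤ ∑ x, π x * (f x - c) ^ 2 := by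
  have hsum : cdf π k * (G - c) ^ 2 + (1 - cdf π m) * c ^ 2 =
      ∑ x, π x * (below k x * (G - c) ^ 2 + (1 - below m x) * c ^ 2) := by
    simp only [mul_add, mul_sub, sub_mul, one_mul, ← mul_assoc, Finset.sum_add_distrib,
      Finset.sum_sub_distrib, ← Finset.sum_mul, hπ.2, cdf, dotProduct]
  rw [hsum]
  refine Finset.sum_le_sum fun x _ => mul_le_mul_of_nonneg_left ?_ (hπ.1 x)
  by_cases hk : (x : ℕ) < k
  · simp [below, hk, hk.trans_le hkm, hlow x hk]
  · by_cases hm : (x : ℕ) < m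
    · simp [below, hk, hm, sq_nonneg]
    · simp [below, hk, hm, hhigh x (not_lt.1 hm)]

namespace IsIrreducibleBirthDeathChain

variable (C : IsIrreducibleBirthDeathChain P π)
include C

lemma cdf_succ_pos {i : ℕ} (hi : i ≤ n) : 0 < cdf π (i + 1) := by
  have := cdf_coe_succ π ⟨i, Nat.lt_succ_of_le hi⟩
  simp only at this
  rw [this]
  exact add_pos_of_nonneg_of_pos (cdf_nonneg C.stationary.1 i) (C.pos _)

lemma resist_nonneg (m x : ℕ) : 0 ≤ resist P π m x := C.potential_nonneg (fun _ => zero_le_one) m x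

lemma resist_pos {i m : ℕ} (hi : i < m) (hm : m ≤ n) : 0 < resist P π m i := by
  rw [resist, potential_of_lt hi]
  exact add_pos_of_pos_of_nonneg (div_pos one_pos (C.conductance_pos (hi.trans_le hm)))
    (C.resist_nonneg m (i + 1))

lemma dirichletForm_potential_unitCurrent {i m : ℕ} (hi : i < m) (hm : m ≤ n) :
    dirichletForm P π (fun x => potential P π (unitCurrent i) m x) = resist P π m i := by
  set f : Fin (n + 1) → ℝ := fun x => potential P π (unitCurrent i) m x with hf
  have hsource : ∀ x : Fin (n + 1), (x : ℕ) < m →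
      π x * (f x - (P *ᵥ f) x) = if (x : ℕ) = i then 1 else 0 := fun x hx => by
    have h := C.mul_mulVec_potential_sub (a := unitCurrent i) (if_neg (Nat.not_lt_zero i)) hm hx
    rw [← neg_sub ((P *ᵥ f) x), mul_neg, hf, h, neg_sub, unitCurrent, unitCurrent]
    split_ifs <;> first | omega | norm_num
  have hterm : ∀ x : Fin (n + 1), f x * (π x * (f x - (P *ᵥ f) x)) =
      if (x : ℕ) = i then resist P π m i else 0 := fun x => by
    rcases lt_or_ge (x : ℕ) m with hx | hx
    · rw [hsource x hx, mul_ite, mul_one, mul_zero]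
      refine ite_congr rfl (fun h => ?_) fun _ => rfl
      exact potential_unitCurrent_of_le h.le hi.le
    · rw [hf]
      simp only [potential_of_le hx, zero_mul]
      rw [if_neg (hi.trans_le hx).ne']
  simp only [dirichletForm, hterm, sum_ite_coe_eq, if_pos (hi.le.trans hm)]

lemma cdf_mul_resist_le {R : ℝ} (hR : HasPoincare P π R) {i m : ℕ} (hi : i < m) (hm : m ≤ n) :
    cdf π (i + 1) * (1 - cdf π m) * resist P π m i ≤ R * (cdf π (i + 1) + (1 - cdf π m)) := by
  set f : Fin (n + 1) → ℝ := fun x => potential P π (unitCurrent i) m x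
  have hvar := cdf_mul_sq_add_le C.stationary.1 (f := f) hi
    (fun x hx => potential_unitCurrent_of_le (Nat.lt_succ_iff.1 hx) hi.le)
    (fun x hx => potential_of_le hx) (π ⬝ᵥ f)
  have henergy := (hR f).trans_eq (congrArg _ (C.dirichletForm_potential_unitCurrent hi hm))
  have hF := C.cdf_succ_pos (hi.le.trans hm)
  have hB := sub_nonneg.2 (cdf_le_one C.stationary.1 m)
  have hG := C.resist_pos hi hm
  set F := cdf π (i + 1)
  set B := 1 - cdf π m
  set G := resist P π m i
  set c := π ⬝ᵥ f
  refine le_of_mul_le_mul_right ?_ hG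
  calc F * B * G * G ≤ F * B * G * G + (F * (G - c) - B * c) ^ 2 :=
        le_add_of_nonneg_right (sq_nonneg _)
    _ = (F * (G - c) ^ 2 + B * c ^ 2) * (F + B) := by ring
    _ ≤ R * G * (F + B) :=
        mul_le_mul_of_nonneg_right (hvar.trans henergy) (add_nonneg hF.le hB)
    _ = R * (F + B) * G := by ring

lemma mul_resist_le {R : ℝ} (hR : HasPoincare P π R) (hR₀ : 0 ≤ R) {i m : ℕ} (hi : i ≤ m)
    (hm : m ≤ n) {δ : ℝ} (hδ : δ ≤ cdf π (i + 1)) (hδ' : δ ≤ 1 - cdf π m) :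
    δ * resist P π m i ≤ 2 * R := by
  rcases hi.eq_or_lt with rfl | hi
  · rw [resist, potential_of_le le_rfl]
    linarith
  have hF := C.cdf_succ_pos (hi.le.trans hm)
  have hB := sub_nonneg.2 (cdf_le_one C.stationary.1 m)
  have hresist := C.cdf_mul_resist_le hR hi hm
  refine le_of_mul_le_mul_right ?_ (add_pos_of_pos_of_nonneg hF hB)
  have := mul_le_mul_of_nonneg_right hδ (mul_nonneg hB (C.resist_nonneg m i))
  have := mul_le_mul_of_nonneg_right hδ' (mul_nonneg hF.le (C.resist_nonneg m i))
  linarith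

lemma cdf_mul_resist_mul_le {R : ℝ} (hR : HasPoincare P π R) {i m : ℕ} (hi : i < m)
    (hm : m ≤ n) : cdf π (i + 1) * resist P π m i * (1 - cdf π m) ≤ R := by
  have hF := C.cdf_succ_pos (hi.le.trans hm)
  have hB := sub_nonneg.2 (cdf_le_one C.stationary.1 m)
  have hresist := C.cdf_mul_resist_le hR hi hm
  have hR₀ : 0 ≤ R := nonneg_of_mul_nonneg_left
    ((mul_nonneg (mul_nonneg hF.le hB) (C.resist_nonneg m i)).trans hresist)
    (add_pos_of_pos_of_nonneg hF hB)
  have hFB : cdf π (i + 1) + (1 - cdf π m) ≤ 1 := by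
    linarith [cdf_mono C.stationary.1 (Nat.succ_le_of_lt hi)]
  linarith [mul_le_mul_of_nonneg_left hFB hR₀]

lemma hitEnergy_le (i : ℕ) : hitEnergy P π i ≤
    ∑ j ∈ Finset.range i, 2 * (cdf π (j + 1) ^ 2 / conductance P π j) := by
  have hshift : ∑ j ∈ Finset.range i, cdf π j ^ 2 / conductance P π (j - 1) ≤
      ∑ j ∈ Finset.range i, cdf π (j + 1) ^ 2 / conductance P π j := by
    rcases i with _ | i
    · rfl
    · rw [Finset.sum_range_succ', Finset.sum_range_succ, cdf_zero]
      refine add_le_add le_rfl ?_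
      rw [zero_pow two_ne_zero, zero_div]
      exact div_nonneg (sq_nonneg _) (C.conductance_nonneg i)
  rw [hitEnergy, Finset.sum_add_distrib, ← Finset.mul_sum, two_mul]
  linarith

lemma hitVar_zero_le_sum (m : ℕ) : hitVar P π m 0 ≤
    ∑ j ∈ Finset.range m, 2 * (cdf π (j + 1) ^ 2 / conductance P π j) * resist P π m j :=
  calc hitVar P π m 0
      ≤ ∑ i ∈ Finset.Ico 0 m, ∑ j ∈ Finset.range (i + 1),
          2 * (cdf π (j + 1) ^ 2 / conductance P π j) * (1 / conductance P π i) := by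
        rw [hitVar, potential]
        refine Finset.sum_le_sum fun i _ => ?_
        rw [← Finset.sum_mul, div_eq_mul_one_div]
        exact mul_le_mul_of_nonneg_right (C.hitEnergy_le (i + 1))
          (div_nonneg zero_le_one (C.conductance_nonneg i))
    _ = ∑ j ∈ Finset.range m, ∑ i ∈ Finset.Ico j m,
          2 * (cdf π (j + 1) ^ 2 / conductance P π j) * (1 / conductance P π i) := by
        refine Finset.sum_comm' fun i j => ?_
        simp only [Finset.mem_Ico, Finset.mem_range]
        omega
    _ = _ := by simp only [← Finset.mul_sum]; rfl

lemma one_sub_cdf_mul_hitVar_le {R : ℝ} (hR : HasPoincare P π R) {m : ℕ} (hm : m ≤ n) :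
    (1 - cdf π m) * hitVar P π m 0 ≤ 2 * R * hitMean P π m 0 := by
  refine (mul_le_mul_of_nonneg_left (C.hitVar_zero_le_sum m)
    (sub_nonneg.2 (cdf_le_one C.stationary.1 m))).trans ?_
  rw [hitMean, potential, ← Finset.range_eq_Ico, Finset.mul_sum, Finset.mul_sum]
  refine Finset.sum_le_sum fun j hj => ?_
  calc (1 - cdf π m) * (2 * (cdf π (j + 1) ^ 2 / conductance P π j) * resist P π m j)
      = 2 * (cdf π (j + 1) / conductance P π j) *
          (cdf π (j + 1) * resist P π m j * (1 - cdf π m)) := by ring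
    _ ≤ 2 * (cdf π (j + 1) / conductance P π j) * R :=
        mul_le_mul_of_nonneg_left (C.cdf_mul_resist_mul_le hR (Finset.mem_range.1 hj) hm)
          (mul_nonneg zero_le_two
            (div_nonneg (cdf_nonneg C.stationary.1 _) (C.conductance_nonneg j)))
    _ = _ := by ring

lemma hitMean_le_add_resist {a b : ℕ} (hab : a ≤ b) :
    hitMean P π b 0 ≤ hitMean P π a 0 + resist P π b a := by
  rw [hitMean, potential, ← Finset.sum_Ico_consecutive _ (Nat.zero_le a) hab]
  exact add_le_add_right (Finset.sum_le_sum fun i _ =>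
    div_le_div_of_nonneg_right (cdf_le_one C.stationary.1 _) (C.conductance_nonneg i)) _

lemma hitMean_zero_le {m T : ℕ} (hm : m ≤ n) (hcdf : cdf π m ≤ 1 / 4)
    (hT : tvDist ((P ^ T) 0) π ≤ 1 / 4) : hitMean P π m 0 ≤ 2 * T := by
  have hdist : (P ^ T *ᵥ below m) 0 - cdf π m ≤ tvDist ((P ^ T) 0) π :=
    dotProduct_sub_dotProduct_le_tvDist ((sum_pow_apply C.stochastic T 0).trans
      C.stationary.1.2.symm) (below_nonneg m) (below_le_one m)
  have hhit := C.hitMean_mul_le hm T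
  have := mul_le_mul_of_nonneg_left (show 1 / 2 ≤ 1 - (P ^ T *ᵥ below m) 0 by linarith)
    (C.hitMean_nonneg m 0)
  linarith

end IsIrreducibleBirthDeathChain

end Resistance

section Window

lemma rpow_three_halves_sq {x : ℝ} (hx : 0 ≤ x) : (x ^ (3 / 2 : ℝ)) ^ 2 = x ^ 3 := by
  rw [← Real.rpow_mul_natCast hx, ← Real.rpow_natCast]
  norm_num

variable {n : ℕ} {P : Matrix (Fin (n + 1)) (Fin (n + 1)) ℝ} {π : Fin (n + 1) → ℝ}

namespace IsIrreducibleBirthDeathChain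

variable (C : IsIrreducibleBirthDeathChain P π)
include C

lemma mul_hitVar_le {R : ℝ} (hR : HasPoincare P π R) (hR₀ : 0 ≤ R) {m : ℕ} (hm : m ≤ n) {δ M : ℝ}
    (hδ : δ ≤ 1 - cdf π m) (hM : hitMean P π m 0 ≤ M) : δ * hitVar P π m 0 ≤ 2 * R * M :=
  calc δ * hitVar P π m 0 ≤ (1 - cdf π m) * hitVar P π m 0 :=
        mul_le_mul_of_nonneg_right hδ (C.hitVar_nonneg m 0)
    _ ≤ 2 * R * hitMean P π m 0 := C.one_sub_cdf_mul_hitVar_le hR hm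
    _ ≤ 2 * R * M := mul_le_mul_of_nonneg_left hM (by positivity)

lemma hitVar_div_sq_lt {R : ℝ} (hR : HasPoincare P π R) (hR₀ : 0 ≤ R) {a : ℕ} (ha : a ≤ n)
    {ε w T : ℝ} (hε₀ : 0 < ε) (hε : ε < 1 / 2) (hw : 0 < w) (hRT : R * T ≤ ε ^ 3 * w ^ 2)
    (hcdf : cdf π a ≤ ε / 4) (hmean : hitMean P π a 0 ≤ 2 * T) :
    hitVar P π a 0 / (2 * w) ^ 2 < 3 * ε / 4 := by
  have hvar := C.mul_hitVar_le hR hR₀ ha (δ := 7 / 8) (by linarith) hmean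
  rw [div_lt_iff₀ (by positivity)]
  calc hitVar P π a 0 ≤ 32 / 7 * (ε ^ 3 * w ^ 2) := by linarith
    _ < 3 * ε / 4 * (2 * w) ^ 2 := by
      have : 0 < ε * w ^ 2 := by positivity
      nlinarith [mul_lt_mul_of_pos_left (show ε ^ 2 < 1 / 2 by nlinarith) this]

lemma hitVar_div_sq_le {R : ℝ} (hR : HasPoincare P π R) (hR₀ : 0 ≤ R) {b : ℕ} (hb : b ≤ n)
    {ε w T : ℝ} (hε₀ : 0 < ε) (hw : 0 < w) (hRT : R * T ≤ ε ^ 3 * w ^ 2)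
    (hcdf : ε / 4 ≤ 1 - cdf π b) (hmean : hitMean P π b 0 ≤ 17 * T / ε) :
    hitVar P π b 0 / (24 * w) ^ 2 ≤ ε / 4 := by
  have hvar := C.mul_hitVar_le hR hR₀ hb hcdf hmean
  rw [div_le_iff₀ (by positivity)]
  refine le_of_mul_le_mul_left ?_ (show 0 < ε / 4 * ε by positivity)
  calc ε / 4 * ε * hitVar P π b 0 = ε * (ε / 4 * hitVar P π b 0) := by ring
    _ ≤ ε * (2 * R * (17 * T / ε)) := mul_le_mul_of_nonneg_left hvar hε₀.le
    _ = 34 * (R * T) := by field_simp; ring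
    _ ≤ 34 * (ε ^ 3 * w ^ 2) := by linarith
    _ ≤ ε / 4 * ε * (ε / 4 * (24 * w) ^ 2) := by
      have : 0 < ε ^ 3 * w ^ 2 := by positivity
      linarith

lemma exists_window (hTP : IsTP2 P) {R : ℝ} (hR : HasPoincare P π R) {ε w : ℝ} {T : ℕ}
    (hε₀ : 0 < ε) (hε : ε < 1 / 2) (hw : 0 < w) (hR₁ : 1 ≤ R) (hR₂ : R ≤ 2 * T)
    (hRT : R * T ≤ ε ^ 3 * w ^ 2) (hT : tvDist ((P ^ T) 0) π ≤ 1 / 4) :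
    ∃ U : ℝ, 0 ≤ U ∧ (∀ t : ℕ, U ≤ t → ∀ k, (P ^ t *ᵥ below k) 0 - cdf π k ≤ ε / 2) ∧
      ∀ t : ℕ, t ≤ U - 34 * w → 1 - ε < tvDist ((P ^ t) 0) π := by
  have hR₀ : 0 ≤ R := zero_le_one.trans hR₁
  obtain ⟨a, ha, ha'⟩ := exists_quantile C.stationary.1 (α := ε / 4) (by linarith) (by linarith)
  obtain ⟨b, hb, hb'⟩ := exists_quantile C.stationary.1 (α := 1 - ε / 4) (by linarith)
    (by linarith)
  have hab : (a : ℕ) ≤ b := by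
    by_contra! h
    linarith [cdf_mono C.stationary.1 (Nat.succ_le_of_lt h)]
  have hmean_a : hitMean P π a 0 ≤ 2 * T := C.hitMean_zero_le a.is_le (by linarith) hT
  have hmean_ab : hitMean P π b 0 ≤ hitMean P π a 0 + resist P π b a := C.hitMean_le_add_resist hab
  have hresist : resist P π b a ≤ 8 * R / ε := by
    rw [le_div_iff₀ hε₀]
    linarith [C.mul_resist_le hR hR₀ hab b.is_le ha' (by linarith)]
  have hRw : 8 * R / ε ≤ 8 * w := by
    rw [div_le_iff₀ hε₀, mul_assoc]
    refine mul_le_mul_of_nonneg_left (abs_le_of_sq_le_sq' ?_ (by positivity)).2 (by norm_num)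
    nlinarith [show 0 ≤ w ^ 2 * ε ^ 2 by positivity]
  have hmean_b : hitMean P π b 0 ≤ 17 * T / ε := by
    have : 2 * (T : ℝ) ≤ T / ε := by
      rw [le_div_iff₀ hε₀]
      nlinarith
    have : 8 * R / ε ≤ 16 * (T / ε) := by
      rw [mul_div_assoc', div_le_div_iff_of_pos_right hε₀]
      linarith
    rw [mul_div_assoc]
    linarith
  have hvar_a := C.hitVar_div_sq_lt hR hR₀ a.is_le hε₀ hε hw hRT ha.le hmean_a
  have hvar_b := C.hitVar_div_sq_le hR hR₀ b.is_le hε₀ hw hRT (by linarith) hmean_b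
  refine ⟨hitMean P π b 0 + 24 * w, add_nonneg (C.hitMean_nonneg b 0) (by positivity),
    fun t ht k => ?_, fun t ht => ?_⟩
  · linarith [C.pow_mulVec_below_zero_sub_cdf_le hTP b.is_le (A := 24 * w) (by positivity) ht k]
  · linarith [C.one_sub_cdf_sub_le_tvDist a.is_le (A := 2 * w) (by positivity) (t := t)
      (by linarith)]

lemma exists_two_sided_window (hTP : IsTP2 P) {R : ℝ} (hR : HasPoincare P π R) {ε w : ℝ} {T : ℕ}
    (hε₀ : 0 < ε) (hε : ε < 1 / 2) (hw : 0 < w) (hR₁ : 1 ≤ R) (hR₂ : R ≤ 2 * T)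
    (hRT : R * T ≤ ε ^ 3 * w ^ 2) (hT : worstDist P π T ≤ 1 / 4) :
    ∃ U : ℝ, 0 ≤ U ∧ (∀ t : ℕ, U ≤ t → worstDist P π t ≤ ε) ∧
      ∀ t : ℕ, t ≤ U - 34 * w → 1 - ε < worstDist P π t := by
  obtain ⟨U, hU₀, hU, hU'⟩ := C.exists_window hTP hR hε₀ hε hw hR₁ hR₂ hRT
    ((tvDist_le_worstDist T 0).trans hT)
  obtain ⟨V, -, hV, hV'⟩ := C.rev.exists_window
    (hTP.submatrix_antitone Fin.rev_anti Fin.rev_anti) hR.rev hε₀ hε hw hR₁ hR₂ hRT <| by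
      rw [tvDist_submatrix_rev]
      exact (tvDist_le_worstDist T _).trans hT
  refine ⟨max U V, le_max_of_le_left hU₀, fun t ht => ?_, fun t ht => ?_⟩
  · exact (C.worstDist_le_add hTP (hU t ((le_max_left U V).trans ht))
      (hV t ((le_max_right U V).trans ht))).trans_eq (add_halves ε)
  · rcases max_cases U V with ⟨h, -⟩ | ⟨h, -⟩ <;> rw [h] at ht
    · exact (hU' t ht).trans_le (tvDist_le_worstDist t 0)
    · refine (hV' t ht).trans_le ?_
      rw [tvDist_submatrix_rev]
      exact tvDist_le_worstDist t _

lemma tMix_sub_tMix_le_of_hasPoincare [Nontrivial (Fin (n + 1))] (hTP : IsTP2 P) {R : ℝ}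
    (hR : HasPoincare P π R) (hR₁ : 1 ≤ R) (hR₂ : R ≤ 2 * tMix P π (1 / 4)) {ε : ℝ} (hε₀ : 0 < ε)
    (hε : ε < 1 / 2) :
    (tMix P π ε : ℝ) - tMix P π (1 - ε) ≤ 35 / ε ^ (3 / 2 : ℝ) * √(R * tMix P π (1 / 4)) := by
  have hex : ∃ t, worstDist P π t ≤ 1 / 4 := C.exists_worstDist_le hTP (by norm_num)
  have hT₁ : (1 : ℝ) ≤ tMix P π (1 / 4) :=
    Nat.one_le_cast.2 (one_le_tMix C.stationary.1 (by norm_num) hex)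
  set T := tMix P π (1 / 4)
  have hRT : 1 ≤ R * T := one_le_mul_of_one_le_of_one_le hR₁ hT₁
  set w := √(R * T) / ε ^ (3 / 2 : ℝ) with hw
  have hw₁ : 1 ≤ w := by
    rw [hw, one_le_div (Real.rpow_pos_of_pos hε₀ _)]
    exact (Real.rpow_le_one hε₀.le (by linarith) (by norm_num)).trans (Real.one_le_sqrt.2 hRT)
  have hw₂ : R * T = ε ^ 3 * w ^ 2 := by
    rw [hw, div_pow, Real.sq_sqrt (by linarith), rpow_three_halves_sq hε₀.le,
      mul_div_cancel₀ _ (by positivity)]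
  obtain ⟨U, hU₀, hU, hU'⟩ := C.exists_two_sided_window hTP hR hε₀ hε (by linarith) hR₁ hR₂ hw₂.le
    (worstDist_tMix_le hex)
  calc (tMix P π ε : ℝ) - tMix P π (1 - ε) ≤ 34 * w + 1 :=
        tMix_sub_tMix_le_of_window (by linarith) hU₀ hU hU'
    _ ≤ 35 * w := by linarith
    _ = 35 / ε ^ (3 / 2 : ℝ) * √(R * T) := by rw [hw]; ring

end IsIrreducibleBirthDeathChain

end Window

lemma windowConst_pos (ε : ℝ) : 0 < windowConst ε :=
  lt_max_of_lt_right (lt_max_of_lt_right (by norm_num))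

lemma le_windowConst {ε : ℝ} (hε₀ : 0 < ε) : 35 / ε ^ (3 / 2 : ℝ) ≤ windowConst ε := by
  have hpos : 0 < ε ^ (3 / 2 : ℝ) := Real.rpow_pos_of_pos hε₀ _
  rcases le_or_gt (1 / 12) ε with h | h
  · have hcube : (1 / 12 : ℝ) ^ 3 ≤ (ε ^ (3 / 2 : ℝ)) ^ 2 := by
      rw [rpow_three_halves_sq hε₀.le]
      exact pow_le_pow_left₀ (by norm_num) h 3
    refine le_max_of_le_left (le_trans ?_ (mul_le_mul_of_nonneg_left (le_max_right _ _)
      (by norm_num)))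
    rw [div_le_iff₀ hpos]
    nlinarith
  · have hlog : 3 ≤ Real.logb 2 (1 / ε) := by
      rw [Real.le_logb_iff_rpow_le (by norm_num) (by positivity), le_div_iff₀ hε₀]
      norm_num
      linarith
    refine le_max_of_le_right (le_max_of_le_left ?_)
    rw [show (5 / 2 : ℝ) = 3 / 2 + 1 by norm_num, Real.rpow_add_one hε₀.ne',
      div_le_div_iff₀ hpos (by positivity)]
    linarith [mul_le_mul_of_nonneg_right (show 35 * ε ≤ Real.logb 2 (1 / ε) by linarith) hpos.le]

end BirthDeath

open BirthDeath in
theorem theorem1_general {n : ℕ} {P : Matrix (Fin (n + 1)) (Fin (n + 1)) ℝ} {π : Fin (n + 1) → ℝ}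
    (hBD : IsBirthDeathChain P) (hirr : P.IsIrreducible) (hTP : IsTP2 P)
    (hπ : IsStationaryDistribution P π) {ε : ℝ} (hε₀ : 0 < ε) (hε : ε < 1 / 2) :
    (tMix P π ε : ℝ) - tMix P π (1 - ε) ≤
      35 / ε ^ (3 / 2 : ℝ) * √(tRel P * tMix P π (1 / 4)) := by
  have C : IsIrreducibleBirthDeathChain P π := ⟨hBD, hirr, hπ⟩
  rcases subsingleton_or_nontrivial (Fin (n + 1)) with _ | _
  · rw [tMix_eq_zero_of_subsingleton hπ.1 hε₀.le, Nat.cast_zero, zero_sub]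
    exact (neg_nonpos.2 (Nat.cast_nonneg _)).trans (by positivity)
  have hex : ∃ t, worstDist P π t ≤ 1 / 4 := C.exists_worstDist_le hTP (by norm_num)
  have hT : 1 ≤ tMix P π (1 / 4) := one_le_tMix hπ.1 (by norm_num) hex
  have hgap : 0 < gap P :=
    lt_of_lt_of_le (by positivity) (hπ.one_div_two_mul_le_gap hT (worstDist_tMix_le hex))
  exact C.tMix_sub_tMix_le_of_hasPoincare hTP
    (hπ.hasPoincare_tRel hBD.stochastic hirr C.isReversible hgap) (one_le_tRel hgap)
    (hπ.tRel_le hT (worstDist_tMix_le hex)) hε₀ hε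

theorem theorem1 (ε : ℝ) (hε₀ : 0 < ε) (hε : ε < 1 / 2) :
    0 < BirthDeath.windowConst ε ∧
    ∀ (n : ℕ) (P : Matrix (Fin (n + 1)) (Fin (n + 1)) ℝ) (π : Fin (n + 1) → ℝ),
      BirthDeath.IsBirthDeathChain P → P.IsIrreducible → BirthDeath.IsLazy P →
      BirthDeath.IsStationaryDistribution P π →
      (BirthDeath.tMix P π ε : ℝ) - (BirthDeath.tMix P π (1 - ε) : ℝ) ≤
        BirthDeath.windowConst ε *
          √(BirthDeath.tRel P * (BirthDeath.tMix P π (1 / 4) : ℝ)) :=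
  ⟨BirthDeath.windowConst_pos ε, fun _ _ _ hBD hirr hlazy hπ =>
    (theorem1_general hBD hirr (hBD.isTP2 hlazy) hπ hε₀ hε).trans
      (mul_le_mul_of_nonneg_right (BirthDeath.le_windowConst hε₀) (Real.sqrt_nonneg _))⟩
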